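/- **Setting.** An N-function is a continuous convex function $B:[0,\infty)\to[0,\infty)$ with $B(t)>0$ for $t>0$, $B(t)/t\to0$ as $t\to0^+$ and $B(t)/t\to\infty$ as $t\to\infty$. It satisfies $\Delta_2$ if there are $\alpha>0$, $t_0\ge0$ with $B(2t)\le\alpha B(t)$ for all $t\ge t_0$, and $\nabla_2$ if its complementary function $\widetilde B(t)=\sup_{s\ge0}\{st-B(s)\}$ satisfies $\Delta_2$. For a measurable set $D$ in a Euclidean space, $L^B(D)$ is the space of (classes of a.e. equal) measurable $u:D\to\mathbb R$ with $\lim_{\delta\to0^+}\int_D B(\delta|u|)=0$, with the Luxemburg norm $\|u\|_{L^B(D)}=\inf\{k>0:\int_D B(|u|/k)\le1\}$. Let $d\ge1$, and let $Y\subset\mathbb R^d$ be a reference cell: a bounded open set for which there is a basis $b_1,\dots,b_d$ of $\mathbb R^d$ such that a.e. $z\in\mathbb R^d$ lies in $\xi+Y$ for exactly one lattice point $\xi=\sum_h n_hb_h$, $n_h\in\mathbb Z$ (for instance $Y=(0,1)^d$ with the canonical basis); this $\xi$ is denoted $[z]_Y$. Let $|Y|$ be the Lebesgue measure of $Y$,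 and let $\Omega\subset\mathbb R^d$ be bounded and open. For $\varepsilon>0$ let $\widehat\Omega_\varepsilon$ be the interior of the union of the sets $\varepsilon(\xi+\overline Y)$ over all lattice points $\xi$ with $\varepsilon(\xi+Y)\subset\Omega$. The unfolding operator is $\mathcal T_\varepsilon(\phi)(x,y)=\phi(\varepsilon[x/\varepsilon]_Y+\varepsilon y)$ for a.e. $(x,y)\in(\widehat\Omega_\varepsilon\cap\Omega)\times Y$, and $\mathcal T_\varepsilon(\phi)(x,y)=0$ for a.e. $(x,y)\in(\Omega\setminus\widehat\Omega_\varepsilon)\times Y$; it maps $L^B(\Omega)$ to $L^B(\Omega\times Y)$. The mean value operator $\mathcal M_Y:L^B(\Omega\times Y)\to L^B(\Omega)$ is $\mathcal M_Y(w)(x)=\frac1{|Y|}\int_Yw(x,y)\,dy$. A function $w\in L^B(\Omega)$ is identified with $(x,y)\mapsto w(x)$ in $L^B(\Omega\times Y)$. **Theorem.** Let $B$ be an N-function satisfying $\Delta_2$ and $\nabla_2$, and let $\varepsilon$ run through a sequence of positive numbers tending to $0$. (i) For every $w\in L^B(\Omega)$, $\mathcal T_\varepsilon(w)\to w$ strongly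 in $L^B(\Omega\times Y)$. (ii) If $w_\varepsilon\to w$ strongly in $L^B(\Omega)$, then $\mathcal T_\varepsilon(w_\varepsilon)\to w$ strongly in $L^B(\Omega\times Y)$. (iii) If $\{w_\varepsilon\}$ is relatively weakly compact in $L^B(\Omega)$, then $\{\mathcal T_\varepsilon(w_\varepsilon)\}$ is relatively weakly compact in $L^B(\Omega\times Y)$; if furthermore $\mathcal T_\varepsilon(w_\varepsilon)\rightharpoonup\widehat w$ weakly in $L^B(\Omega\times Y)$, then $w_\varepsilon\rightharpoonup\mathcal M_Y(\widehat w)$ weakly in $L^B(\Omega)$. (iv) If $\{w_\varepsilon\}$ is any sequence in $L^B(\Omega)$ with $\mathcal T_\varepsilon(w_\varepsilon)\rightharpoonup\widehat w$ weakly in $L^B(\Omega\times Y)$, then $$\|\widehat w\|_{L^B(\Omega\times Y)}\le\liminf_{\varepsilon\to0}\,(1+|Y|)\,\|w_\varepsilon\|_{L^B(\Omega)},$$ where the right-hand side may be $+\infty$. -/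

import Mathlib

open MeasureTheory Filter Topology Set

noncomputable section

namespace Unfolding

/-! ### N-functions -/

/-- An N-function `B : [0, ∞) → [0, ∞)`: continuous, convex, positive on `(0, ∞)`, with
`B t / t → 0` as `t → 0+` and `B t / t → ∞` as `t → ∞`. Only the values on `[0, ∞)` matter;
`B 0 = 0` and the nonnegativity of `B` there follow from the fields. -/
structure NFunction where
  toFun : ℝ → ℝ
  continuousOn : ContinuousOn toFun (Ici 0)
  convexOn : ConvexOn ℝ (Ici 0) toFun
  pos : ∀ t, 0 < t → 0 < toFun t
  tendsto_div_zero : Tendsto (fun t => toFun t / t) (𝓝[>] 0) (𝓝 0)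
  tendsto_div_atTop : Tendsto (fun t => toFun t / t) atTop atTop

instance : CoeFun NFunction (fun _ => ℝ → ℝ) := ⟨NFunction.toFun⟩

/-- The `Δ₂` condition near infinity. -/
def DeltaTwo (B : ℝ → ℝ) : Prop :=
  ∃ α : ℝ, 0 < α ∧ ∃ t₀ : ℝ, 0 ≤ t₀ ∧ ∀ t, t₀ ≤ t → B (2 * t) ≤ α * B t

/-- The complementary function `t ↦ sup_{s ≥ 0} (s t - B s)`. -/
def conjugate (B : ℝ → ℝ) (t : ℝ) : ℝ := sSup ((fun s => s * t - B s) '' Ici 0)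

/-- The `∇₂` condition: the complementary function satisfies `Δ₂`. -/
def NablaTwo (B : ℝ → ℝ) : Prop := DeltaTwo (conjugate B)

namespace NFunction

variable (B : NFunction)

lemma map_zero : B 0 = 0 := by
  have h1 : Tendsto B (𝓝[>] 0) (𝓝 (B 0)) :=
    (B.continuousOn 0 self_mem_Ici).mono_left (nhdsWithin_mono _ Ioi_subset_Ici_self)
  have h2 : Tendsto (fun t : ℝ => B t / t * t) (𝓝[>] 0) (𝓝 (0 * 0)) :=
    B.tendsto_div_zero.mul (tendsto_id.mono_left nhdsWithin_le_nhds)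
  have h3 : Tendsto B (𝓝[>] 0) (𝓝 (0 * 0)) := by
    refine h2.congr' ?_
    filter_upwards [self_mem_nhdsWithin] with t ht
    exact div_mul_cancel₀ _ (ne_of_gt ht)
  simpa using tendsto_nhds_unique h1 h3

lemma nonneg {t : ℝ} (ht : 0 ≤ t) : 0 ≤ B t := by
  rcases ht.eq_or_lt with rfl | h
  · exact B.map_zero.ge
  · exact (B.pos t h).le

lemma map_mul_le {c t : ℝ} (hc : 0 ≤ c) (hc1 : c ≤ 1) (ht : 0 ≤ t) : B (c * t) ≤ c * B t := by
  have := B.convexOn.2 (x := t) (y := 0) ht self_mem_Ici hc (sub_nonneg.2 hc1) (by ring)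
  simpa [B.map_zero] using this

lemma mono {s t : ℝ} (hs : 0 ≤ s) (hst : s ≤ t) : B s ≤ B t := by
  rcases hs.eq_or_lt with rfl | h
  · rw [B.map_zero]; exact B.nonneg hst
  · have ht : 0 < t := h.trans_le hst
    have h1 := B.map_mul_le (c := s / t) (by positivity) ((div_le_one ht).2 hst) ht.le
    rw [div_mul_cancel₀ _ ht.ne'] at h1
    refine h1.trans ?_
    exact mul_le_of_le_one_left (B.nonneg ht.le) ((div_le_one ht).2 hst)

lemma continuous_abs {c : ℝ} (hc : 0 ≤ c) : Continuous fun t : ℝ => B (c * |t|) :=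
  B.continuousOn.comp_continuous (by fun_prop) fun t => mul_nonneg hc (abs_nonneg t)

end NFunction

/-! ### Orlicz spaces with the Luxemburg norm -/

section Orlicz

variable {α : Type*} [MeasurableSpace α] (B : NFunction) (μ : Measure α)

/-- The modular `∫ B (δ |f|) dμ`. -/
def modular (δ : ℝ) (f : α → ℝ) : ENNReal := ∫⁻ x, ENNReal.ofReal (B (δ * |f x|)) ∂μ

/-- `f` is (almost everywhere equal to) a measurable function with
`∫ B (δ |f|) dμ → 0` as `δ → 0+`. -/
def MemOrlicz (f : α → ℝ) : Prop :=
  AEStronglyMeasurable f μ ∧ Tendsto (fun δ => modular B μ δ f) (𝓝[>] 0) (𝓝 0)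

/-- The Luxemburg norm `inf {k > 0 : ∫ B (|f| / k) dμ ≤ 1}`. -/
def luxemburgNorm (f : α → ℝ) : ℝ :=
  sInf {k : ℝ | 0 < k ∧ ∫⁻ x, ENNReal.ofReal (B (|f x| / k)) ∂μ ≤ 1}

variable {B μ}

lemma modular_congr {f g : α → ℝ} (h : f =ᵐ[μ] g) (δ : ℝ) :
    modular B μ δ f = modular B μ δ g := by
  refine lintegral_congr_ae ?_
  filter_upwards [h] with x hx
  rw [hx]

lemma luxemburgNorm_eq (f : α → ℝ) :
    luxemburgNorm B μ f = sInf {k : ℝ | 0 < k ∧ modular B μ k⁻¹ f ≤ 1} := by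
  simp only [luxemburgNorm, modular, div_eq_inv_mul]

lemma luxemburgNorm_congr {f g : α → ℝ} (h : f =ᵐ[μ] g) :
    luxemburgNorm B μ f = luxemburgNorm B μ g := by
  simp only [luxemburgNorm_eq, modular_congr h]

lemma MemOrlicz.congr {f g : α → ℝ} (hf : MemOrlicz B μ f) (h : f =ᵐ[μ] g) :
    MemOrlicz B μ g :=
  ⟨hf.1.congr h, by simpa only [modular_congr h] using hf.2⟩

lemma modular_mono_right {δ : ℝ} (hδ : 0 ≤ δ) {f g : α → ℝ} (h : ∀ x, |f x| ≤ |g x|) :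
    modular B μ δ f ≤ modular B μ δ g :=
  lintegral_mono fun x => ENNReal.ofReal_le_ofReal
    (B.mono (by positivity) (mul_le_mul_of_nonneg_left (h x) hδ))

lemma aemeasurable_modular {f : α → ℝ} (hf : AEStronglyMeasurable f μ) {δ : ℝ} (hδ : 0 ≤ δ) :
    AEMeasurable (fun x => ENNReal.ofReal (B (δ * |f x|))) μ :=
  ((B.continuous_abs hδ).measurable.comp_aemeasurable hf.aemeasurable).ennreal_ofReal

lemma modular_mul_le {c δ : ℝ} (hc : 0 ≤ c) (hc1 : c ≤ 1) (hδ : 0 ≤ δ) (f : α → ℝ) :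
    modular B μ (c * δ) f ≤ ENNReal.ofReal c * modular B μ δ f := by
  rw [modular, modular, ← lintegral_const_mul' _ _ ENNReal.ofReal_ne_top]
  refine lintegral_mono fun x => ?_
  rw [← ENNReal.ofReal_mul hc, mul_assoc]
  exact ENNReal.ofReal_le_ofReal (B.map_mul_le hc hc1 (by positivity))

lemma modular_zero (δ : ℝ) : modular B μ δ (0 : α → ℝ) = 0 := by
  simp [modular, B.map_zero]

lemma modular_smul (c δ : ℝ) (f : α → ℝ) : modular B μ δ (c • f) = modular B μ (δ * |c|) f := by
  simp [modular, abs_mul, mul_assoc]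

/-- Convexity of the modular. -/
lemma modular_add_le {k l : ℝ} (hk : 0 < k) (hl : 0 < l) {f g : α → ℝ}
    (hf : AEStronglyMeasurable f μ) :
    modular B μ (k + l)⁻¹ (f + g) ≤ ENNReal.ofReal (k / (k + l)) * modular B μ k⁻¹ f
      + ENNReal.ofReal (l / (k + l)) * modular B μ l⁻¹ g := by
  have hkl : 0 < k + l := by positivity
  rw [modular, modular, modular, ← lintegral_const_mul' _ _ ENNReal.ofReal_ne_top,
    ← lintegral_const_mul' _ _ ENNReal.ofReal_ne_top,
    ← lintegral_add_left' ((aemeasurable_modular hf (inv_pos.2 hk).le).const_mul _)]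
  refine lintegral_mono fun x => ?_
  have hf0 : 0 ≤ k⁻¹ * |f x| := by positivity
  have hg0 : 0 ≤ l⁻¹ * |g x| := by positivity
  rw [← ENNReal.ofReal_mul (by positivity), ← ENNReal.ofReal_mul (by positivity),
    ← ENNReal.ofReal_add (mul_nonneg (by positivity) (B.nonneg hf0))
      (mul_nonneg (by positivity) (B.nonneg hg0))]
  refine ENNReal.ofReal_le_ofReal ?_
  have ha : 0 ≤ k / (k + l) := by positivity
  have hb : 0 ≤ l / (k + l) := by positivity
  have h1 := B.convexOn.2 hf0 hg0 ha hb (by field_simp)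
  refine le_trans (B.mono (by positivity) ?_) h1
  have : k / (k + l) * (k⁻¹ * |f x|) + l / (k + l) * (l⁻¹ * |g x|)
      = (k + l)⁻¹ * (|f x| + |g x|) := by field_simp
  simp only [smul_eq_mul]
  rw [this]
  exact mul_le_mul_of_nonneg_left (abs_add_le _ _) (by positivity)

lemma MemOrlicz.zero : MemOrlicz B μ (0 : α → ℝ) :=
  ⟨aestronglyMeasurable_const, by simp only [modular_zero]; exact tendsto_const_nhds⟩

lemma tendsto_mul_nhdsGT {c : ℝ} (hc : 0 < c) :
    Tendsto (fun δ : ℝ => δ * c) (𝓝[>] 0) (𝓝[>] 0) := by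
  refine tendsto_nhdsWithin_iff.2 ⟨?_, ?_⟩
  · have : Tendsto (fun δ : ℝ => δ * c) (𝓝 0) (𝓝 (0 * c)) := tendsto_id.mul_const c
    rw [zero_mul] at this
    exact this.mono_left nhdsWithin_le_nhds
  · filter_upwards [self_mem_nhdsWithin] with δ hδ
    exact mul_pos hδ hc

lemma MemOrlicz.add {f g : α → ℝ} (hf : MemOrlicz B μ f) (hg : MemOrlicz B μ g) :
    MemOrlicz B μ (f + g) := by
  refine ⟨hf.1.add hg.1, ?_⟩
  have h := ((hf.2.comp (tendsto_mul_nhdsGT two_pos)).add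
    (hg.2.comp (tendsto_mul_nhdsGT two_pos)))
  rw [add_zero] at h
  refine tendsto_of_tendsto_of_tendsto_of_le_of_le' tendsto_const_nhds h
    (Eventually.of_forall fun _ => zero_le) ?_
  filter_upwards [self_mem_nhdsWithin] with δ hδ
  have hδ' : (0 : ℝ) < δ := hδ
  have hk : (0 : ℝ) < (δ * 2)⁻¹ := by positivity
  have h1 := modular_add_le (B := B) (μ := μ) (g := g) hk hk hf.1
  have e : ((δ * 2)⁻¹ + (δ * 2)⁻¹)⁻¹ = δ := by field_simp; norm_num
  have e2 : ENNReal.ofReal ((δ * 2)⁻¹ / ((δ * 2)⁻¹ + (δ * 2)⁻¹)) ≤ 1 := by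
    rw [ENNReal.ofReal_le_one]
    exact (div_le_one (by positivity)).2 (by linarith)
  rw [e, inv_inv] at h1
  exact h1.trans (add_le_add (mul_le_of_le_one_left zero_le e2)
    (mul_le_of_le_one_left zero_le e2))

lemma MemOrlicz.smul (c : ℝ) {f : α → ℝ} (hf : MemOrlicz B μ f) : MemOrlicz B μ (c • f) := by
  by_cases hc : c = 0
  · subst hc; simpa using (MemOrlicz.zero (B := B) (μ := μ))
  · refine ⟨hf.1.const_smul c, ?_⟩
    simp only [modular_smul]
    exact hf.2.comp (tendsto_mul_nhdsGT (abs_pos.2 hc))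

lemma MemOrlicz.exists_le_one {f : α → ℝ} (hf : MemOrlicz B μ f) :
    ∃ k : ℝ, 0 < k ∧ modular B μ k⁻¹ f ≤ 1 := by
  have h := (hf.2.eventually_le_const (u := 1) (by norm_num)).and self_mem_nhdsWithin
  obtain ⟨δ, h1, h2⟩ := h.exists
  exact ⟨δ⁻¹, inv_pos.2 h2, by simpa using h1⟩

variable (B μ)

/-- The functions of the Orlicz space, as a subspace of the space of almost everywhere classes. -/
def orliczSubmodule : Submodule ℝ (α →ₘ[μ] ℝ) where
  carrier := {f | MemOrlicz B μ f}
  add_mem' {f g} hf hg := (MemOrlicz.add hf hg).congr (AEEqFun.coeFn_add f g).symm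
  zero_mem' := MemOrlicz.zero.congr AEEqFun.coeFn_zero.symm
  smul_mem' c f hf := (MemOrlicz.smul c hf).congr (AEEqFun.coeFn_smul c f).symm

/-- The Orlicz space `L^B(μ)`: classes of almost everywhere equal functions `f` with
`MemOrlicz B μ f`. -/
abbrev OrliczSpace : Type _ := ↥(orliczSubmodule B μ)

variable {B μ}

/-- The class in `L^B(μ)` of a function. -/
def MemOrlicz.toOrlicz {f : α → ℝ} (hf : MemOrlicz B μ f) : OrliczSpace B μ :=
  ⟨AEEqFun.mk f hf.1, hf.congr (AEEqFun.coeFn_mk f hf.1).symm⟩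

lemma MemOrlicz.coeFn_toOrlicz {f : α → ℝ} (hf : MemOrlicz B μ f) :
    (hf.toOrlicz : α →ₘ[μ] ℝ) =ᵐ[μ] f := AEEqFun.coeFn_mk f hf.1

lemma bddBelow_luxemburg (f : α → ℝ) : BddBelow {k : ℝ | 0 < k ∧ modular B μ k⁻¹ f ≤ 1} :=
  ⟨0, fun _ hk => hk.1.le⟩

lemma luxemburgNorm_nonneg (f : α → ℝ) : 0 ≤ luxemburgNorm B μ f :=
  Real.sInf_nonneg fun _ hk => hk.1.le

lemma luxemburgNorm_smul_le {c : ℝ} (hc : c ≠ 0) {f : α → ℝ} (hf : MemOrlicz B μ f) :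
    luxemburgNorm B μ (c • f) ≤ |c| * luxemburgNorm B μ f := by
  have hc' : 0 < |c| := abs_pos.2 hc
  rw [← div_le_iff₀' hc', luxemburgNorm_eq f]
  refine le_csInf hf.exists_le_one fun k hk => ?_
  rw [div_le_iff₀' hc', luxemburgNorm_eq]
  refine csInf_le (bddBelow_luxemburg _) ⟨mul_pos hc' hk.1, ?_⟩
  rw [modular_smul, mul_inv_rev, mul_assoc, inv_mul_cancel₀ hc'.ne', mul_one]
  exact hk.2

lemma luxemburgNorm_zero : luxemburgNorm B μ (0 : α → ℝ) = 0 := by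
  refine le_antisymm (le_of_forall_pos_le_add fun ε hε => ?_) (luxemburgNorm_nonneg _)
  rw [luxemburgNorm_eq, zero_add]
  exact csInf_le (bddBelow_luxemburg _) ⟨hε, by simp [modular_zero]⟩

lemma luxemburgNorm_smul (c : ℝ) {f : α → ℝ} (hf : MemOrlicz B μ f) :
    luxemburgNorm B μ (c • f) = |c| * luxemburgNorm B μ f := by
  by_cases hc : c = 0
  · subst hc; simp [luxemburgNorm_zero]
  refine le_antisymm (luxemburgNorm_smul_le hc hf) ?_
  have h := luxemburgNorm_smul_le (inv_ne_zero hc) (hf.smul c)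
  rw [smul_smul, inv_mul_cancel₀ hc, one_smul, abs_inv] at h
  rwa [← div_eq_inv_mul, le_div_iff₀' (abs_pos.2 hc)] at h

lemma luxemburgNorm_add_le {f g : α → ℝ} (hf : MemOrlicz B μ f) (hg : MemOrlicz B μ g) :
    luxemburgNorm B μ (f + g) ≤ luxemburgNorm B μ f + luxemburgNorm B μ g := by
  rw [← sub_le_iff_le_add', luxemburgNorm_eq g]
  refine le_csInf hg.exists_le_one fun l hl => ?_
  rw [sub_le_iff_le_add', ← sub_le_iff_le_add, luxemburgNorm_eq f]
  refine le_csInf hf.exists_le_one fun k hk => ?_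
  rw [sub_le_iff_le_add, luxemburgNorm_eq]
  have hkl : 0 < k + l := add_pos hk.1 hl.1
  refine csInf_le (bddBelow_luxemburg _) ⟨hkl, ?_⟩
  refine (modular_add_le hk.1 hl.1 hf.1).trans ?_
  refine (add_le_add (mul_le_of_le_one_right zero_le hk.2)
    (mul_le_of_le_one_right zero_le hl.2)).trans ?_
  rw [← ENNReal.ofReal_add (div_nonneg hk.1.le hkl.le) (div_nonneg hl.1.le hkl.le), ← add_div,
    div_self hkl.ne', ENNReal.ofReal_one]

lemma eq_zero_of_luxemburgNorm {f : α → ℝ} (hf : MemOrlicz B μ f)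
    (h : luxemburgNorm B μ f = 0) : f =ᵐ[μ] 0 := by
  have key : ∀ c : ℝ, 0 < c → c ≤ 1 → modular B μ 1 f ≤ ENNReal.ofReal c := by
    intro c hc hc1
    have hlt : sInf {k : ℝ | 0 < k ∧ modular B μ k⁻¹ f ≤ 1} < c := by
      rw [← luxemburgNorm_eq, h]; exact hc
    obtain ⟨k, ⟨hk0, hk⟩, hkc⟩ := exists_lt_of_csInf_lt hf.exists_le_one hlt
    have h1 := modular_mul_le (B := B) (μ := μ) hk0.le (hkc.le.trans hc1) (inv_pos.2 hk0).le f
    rw [mul_inv_cancel₀ hk0.ne'] at h1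
    exact (h1.trans (mul_le_of_le_one_right zero_le hk)).trans
      (ENNReal.ofReal_le_ofReal hkc.le)
  have h0 : modular B μ 1 f = 0 := by
    refine le_antisymm ?_ zero_le
    have ht : Tendsto (fun c : ℝ => ENNReal.ofReal c) (𝓝[>] 0) (𝓝 0) := by
      have := (ENNReal.continuous_ofReal.tendsto (0 : ℝ))
      rw [ENNReal.ofReal_zero] at this
      exact this.mono_left nhdsWithin_le_nhds
    refine ge_of_tendsto ht ?_
    filter_upwards [Ioc_mem_nhdsGT (zero_lt_one' ℝ)] with c hc
    exact key c hc.1 hc.2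
  rw [modular, lintegral_eq_zero_iff' (aemeasurable_modular hf.1 zero_le_one)] at h0
  filter_upwards [h0] with x hx
  by_contra hne
  have := B.pos |f x| (abs_pos.2 hne)
  simp only [one_mul, Pi.zero_apply, ENNReal.ofReal_eq_zero] at hx
  linarith

instance : Norm (OrliczSpace B μ) := ⟨fun f => luxemburgNorm B μ (f : α →ₘ[μ] ℝ)⟩

lemma norm_def (f : OrliczSpace B μ) : ‖f‖ = luxemburgNorm B μ (f : α →ₘ[μ] ℝ) := rfl

lemma orliczCore : NormedSpace.Core ℝ (OrliczSpace B μ) where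
  norm_nonneg f := luxemburgNorm_nonneg _
  norm_smul c f := by
    rw [norm_def, norm_def, Real.norm_eq_abs, ← luxemburgNorm_smul c f.2]
    exact luxemburgNorm_congr (AEEqFun.coeFn_smul c (f : α →ₘ[μ] ℝ))
  norm_triangle f g := by
    rw [norm_def, norm_def, norm_def]
    exact (luxemburgNorm_congr (AEEqFun.coeFn_add (f : α →ₘ[μ] ℝ) (g : α →ₘ[μ] ℝ))).trans_le
      (luxemburgNorm_add_le f.2 g.2)
  norm_eq_zero_iff f := by
    constructor
    · intro h
      have := eq_zero_of_luxemburgNorm f.2 h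
      ext1
      exact AEEqFun.ext (this.trans AEEqFun.coeFn_zero.symm)
    · rintro rfl
      rw [norm_def]
      exact (luxemburgNorm_congr AEEqFun.coeFn_zero).trans luxemburgNorm_zero

instance : NormedAddCommGroup (OrliczSpace B μ) := NormedAddCommGroup.ofCore orliczCore

instance : NormedSpace ℝ (OrliczSpace B μ) := NormedSpace.ofCore orliczCore

end Orlicz

/-! ### Reference cells and the unfolding operator -/

/-- A reference cell `Y`: a bounded open set with the paving property with respect to a basis
`b` of `ℝ^d`, i.e. almost every `z` lies in `ξ + Y` for exactly one `ξ = ∑ n_h b_h`, `n_h ∈ ℤ`.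
The basic example is `Y = (0,1)^d` with the canonical basis. -/
structure RefCell (d : ℕ) where
  basis : Module.Basis (Fin d) ℝ (EuclideanSpace ℝ (Fin d))
  carrier : Set (EuclideanSpace ℝ (Fin d))
  isOpen : IsOpen carrier
  isBounded : Bornology.IsBounded carrier
  paving : ∀ᵐ z : EuclideanSpace ℝ (Fin d),
    ∃! n : Fin d → ℤ, z - ∑ h, (n h : ℝ) • basis h ∈ carrier

namespace RefCell

variable {d : ℕ} (Y : RefCell d)

/-- The lattice point `∑ n_h b_h`. -/
def node (n : Fin d → ℤ) : EuclideanSpace ℝ (Fin d) := ∑ h, (n h : ℝ) • Y.basis h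

open Classical in
/-- The lattice point `[z]_Y`, the one with `z ∈ [z]_Y + Y` (defined for almost every `z`). -/
def bracket (z : EuclideanSpace ℝ (Fin d)) : EuclideanSpace ℝ (Fin d) :=
  if h : ∃! n : Fin d → ℤ, z - Y.node n ∈ Y.carrier then Y.node h.choose else 0

/-- The set `ε (ξ + S)` for the lattice point `ξ = ∑ n_h b_h`. -/
def scaled (ε : ℝ) (n : Fin d → ℤ) (S : Set (EuclideanSpace ℝ (Fin d))) :
    Set (EuclideanSpace ℝ (Fin d)) := (fun y => ε • (Y.node n + y)) '' S

/-- The index set `Ξ_ε` of the cells `ε (ξ + Y)` contained in `Ω`. -/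
def cells (Ω : Set (EuclideanSpace ℝ (Fin d))) (ε : ℝ) : Set (Fin d → ℤ) :=
  {n | Y.scaled ε n Y.carrier ⊆ Ω}

/-- The set `Ω̂_ε`, the interior of the union of `ε (ξ + closure Y)` over `ξ ∈ Ξ_ε`. -/
def hat (Ω : Set (EuclideanSpace ℝ (Fin d))) (ε : ℝ) : Set (EuclideanSpace ℝ (Fin d)) :=
  interior (⋃ n ∈ Y.cells Ω ε, Y.scaled ε n (closure Y.carrier))

open Classical in
/-- The unfolding of a function: `φ (ε [x/ε]_Y + ε y)` for `x ∈ Ω̂_ε`, and `0` otherwise. -/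
def unfoldFun (Ω : Set (EuclideanSpace ℝ (Fin d))) (ε : ℝ) (φ : EuclideanSpace ℝ (Fin d) → ℝ)
    (p : EuclideanSpace ℝ (Fin d) × EuclideanSpace ℝ (Fin d)) : ℝ :=
  if p.1 ∈ Y.hat Ω ε then φ (ε • Y.bracket (ε⁻¹ • p.1) + ε • p.2) else 0

/-- The mean value `|Y|⁻¹ ∫_Y w (x, y) dy`. -/
def meanFun (w : EuclideanSpace ℝ (Fin d) × EuclideanSpace ℝ (Fin d) → ℝ)
    (x : EuclideanSpace ℝ (Fin d)) : ℝ :=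
  (volume.real Y.carrier)⁻¹ * ∫ y in Y.carrier, w (x, y)

lemma mem_scaled {ε : ℝ} (hε : 0 < ε) {n : Fin d → ℤ} {S : Set (EuclideanSpace ℝ (Fin d))}
    {x : EuclideanSpace ℝ (Fin d)} : x ∈ Y.scaled ε n S ↔ ε⁻¹ • x - Y.node n ∈ S := by
  constructor
  · rintro ⟨y, hy, rfl⟩
    simpa [smul_smul, inv_mul_cancel₀ hε.ne'] using hy
  · intro h
    exact ⟨_, h, by simp [smul_smul, mul_inv_cancel₀ hε.ne']⟩

lemma isOpen_scaled {ε : ℝ} (hε : 0 < ε) (n : Fin d → ℤ) :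
    IsOpen (Y.scaled ε n Y.carrier) := by
  have : Y.scaled ε n Y.carrier = (fun x => ε⁻¹ • x - Y.node n) ⁻¹' Y.carrier := by
    ext x; exact Y.mem_scaled hε
  rw [this]
  exact Y.isOpen.preimage (by fun_prop)

lemma volume_ne_top : volume Y.carrier ≠ ⊤ := Y.isBounded.measure_lt_top.ne

lemma ae_paving {ε : ℝ} (hε : 0 < ε) :
    ∀ᵐ x : EuclideanSpace ℝ (Fin d), ∃! n : Fin d → ℤ, x ∈ Y.scaled ε n Y.carrier := by
  have h : ∀ᵐ x : EuclideanSpace ℝ (Fin d),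
      ∃! n : Fin d → ℤ, ε⁻¹ • x - Y.node n ∈ Y.carrier := by
    have hp := Y.paving
    rw [ae_iff] at hp ⊢
    have := Measure.addHaar_preimage_smul (volume : Measure (EuclideanSpace ℝ (Fin d)))
      (inv_ne_zero hε.ne')
      {z | ¬ ∃! n : Fin d → ℤ, z - ∑ h, (n h : ℝ) • Y.basis h ∈ Y.carrier}
    rw [hp, mul_zero] at this
    exact this
  simpa only [Y.mem_scaled hε] using h

lemma eq_of_mem {ε : ℝ} (hε : 0 < ε) {n m : Fin d → ℤ}
    (h : (Y.scaled ε n Y.carrier ∩ Y.scaled ε m Y.carrier).Nonempty) : n = m := by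
  have hd := Measure.dense_of_ae (Y.ae_paving hε)
  obtain ⟨x, ⟨hn, hm⟩, hx⟩ :=
    hd.inter_open_nonempty _ ((Y.isOpen_scaled hε n).inter (Y.isOpen_scaled hε m)) h
  exact hx.unique hn hm

lemma mem_cells_of_mem_hat {ε : ℝ} (hε : 0 < ε) {Ω : Set (EuclideanSpace ℝ (Fin d))}
    {n : Fin d → ℤ} {x : EuclideanSpace ℝ (Fin d)} (hx : x ∈ Y.scaled ε n Y.carrier)
    (hh : x ∈ Y.hat Ω ε) : n ∈ Y.cells Ω ε := by
  obtain ⟨m, hm, hxm⟩ := mem_iUnion₂.1 (interior_subset hh)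
  have hcl : x ∈ closure (Y.scaled ε m Y.carrier) :=
    image_closure_subset_closure_image (by fun_prop) hxm
  have hne := mem_closure_iff.1 hcl _ (Y.isOpen_scaled hε n) hx
  rwa [Y.eq_of_mem hε hne]

lemma bracket_eq {ε : ℝ} (hε : 0 < ε) {n : Fin d → ℤ} {x : EuclideanSpace ℝ (Fin d)}
    (hx : x ∈ Y.scaled ε n Y.carrier) : Y.bracket (ε⁻¹ • x) = Y.node n := by
  have hu : ∃! m : Fin d → ℤ, ε⁻¹ • x - Y.node m ∈ Y.carrier :=
    ⟨n, (Y.mem_scaled hε).1 hx, fun m hm => Y.eq_of_mem hε ⟨x, (Y.mem_scaled hε).2 hm, hx⟩⟩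
  rw [bracket, dif_pos hu, hu.unique hu.choose_spec.1 ((Y.mem_scaled hε).1 hx)]

lemma unfoldFun_eq_zero {ε : ℝ} (hε : 0 < ε) {Ω : Set (EuclideanSpace ℝ (Fin d))}
    {n : Fin d → ℤ} (hn : n ∉ Y.cells Ω ε) (φ : EuclideanSpace ℝ (Fin d) → ℝ)
    {p : EuclideanSpace ℝ (Fin d) × EuclideanSpace ℝ (Fin d)}
    (hx : p.1 ∈ Y.scaled ε n Y.carrier) : Y.unfoldFun Ω ε φ p = 0 :=
  if_neg fun h => hn (Y.mem_cells_of_mem_hat hε hx h)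

lemma unfoldFun_eq {ε : ℝ} (hε : 0 < ε) {Ω : Set (EuclideanSpace ℝ (Fin d))}
    {n : Fin d → ℤ} (hn : n ∈ Y.cells Ω ε) (φ : EuclideanSpace ℝ (Fin d) → ℝ)
    {p : EuclideanSpace ℝ (Fin d) × EuclideanSpace ℝ (Fin d)}
    (hx : p.1 ∈ Y.scaled ε n Y.carrier) :
    Y.unfoldFun Ω ε φ p = φ (ε • (Y.node n + p.2)) := by
  have hsub : Y.scaled ε n Y.carrier ⊆ ⋃ n ∈ Y.cells Ω ε, Y.scaled ε n (closure Y.carrier) :=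
    (image_mono subset_closure).trans (subset_biUnion_of_mem (u := fun n =>
      Y.scaled ε n (closure Y.carrier)) hn)
  have hh : p.1 ∈ Y.hat Ω ε := interior_maximal hsub (Y.isOpen_scaled hε n) hx
  rw [unfoldFun, if_pos hh, Y.bracket_eq hε hx, smul_add]

/-- The change of variables `y ↦ ε (ξ + y)` from `Y` onto a cell. -/
lemma exists_map_eq {ε : ℝ} (hε : 0 < ε) (n : Fin d → ℤ) :
    Measurable (fun y : EuclideanSpace ℝ (Fin d) => ε • (Y.node n + y)) ∧ ∃ c : ENNReal,
      (volume.restrict Y.carrier).map (fun y => ε • (Y.node n + y))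
          = c • volume.restrict (Y.scaled ε n Y.carrier)
        ∧ volume (Y.scaled ε n Y.carrier) * c = volume Y.carrier := by
  let e := (Homeomorph.addLeft (Y.node n)).trans (Homeomorph.smulOfNeZero ε hε.ne')
  have he : (fun y => ε • (Y.node n + y)) = e := rfl
  have hme : MeasurableEmbedding e := e.measurableEmbedding
  have hmap : ∃ c : ENNReal, (volume : Measure (EuclideanSpace ℝ (Fin d))).map e
      = c • volume := by
    refine ⟨ENNReal.ofReal |(ε ^ Module.finrank ℝ (EuclideanSpace ℝ (Fin d)))⁻¹|, ?_⟩
    rw [← Measure.map_addHaar_smul volume hε.ne']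
    conv_rhs => rw [← map_add_left_eq_self volume (Y.node n)]
    rw [Measure.map_map (by fun_prop) (by fun_prop)]
    rfl
  obtain ⟨c, hc⟩ := hmap
  have hpre : e ⁻¹' (Y.scaled ε n Y.carrier) = Y.carrier :=
    preimage_image_eq _ e.injective
  refine ⟨he ▸ hme.measurable, c, ?_, ?_⟩
  · rw [he, ← Measure.restrict_smul, ← hc, hme.restrict_map, hpre]
  · have := congrArg (fun m : Measure _ => m (Y.scaled ε n Y.carrier)) hc
    simp only [hme.map_apply, hpre, Measure.smul_apply, smul_eq_mul] at this
    rw [this, mul_comm]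

variable {B : NFunction} {Ω : Set (EuclideanSpace ℝ (Fin d))} {ε : ℝ}

lemma ae_le_iUnion (hε : 0 < ε) :
    (Ω ×ˢ Y.carrier : Set (EuclideanSpace ℝ (Fin d) × EuclideanSpace ℝ (Fin d))) ≤ᵐ[volume]
      (⋃ n, Y.scaled ε n Y.carrier ×ˢ Y.carrier : Set _) := by
  have h := Measure.quasiMeasurePreserving_fst
    (μ := (volume : Measure (EuclideanSpace ℝ (Fin d))))
    (ν := (volume : Measure (EuclideanSpace ℝ (Fin d)))) |>.ae (Y.ae_paving hε)
  filter_upwards [h] with p hp hpY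
  obtain ⟨n, hn, -⟩ := hp
  exact mem_iUnion.2 ⟨n, hn, hpY.2⟩

lemma restrict_prod_eq (S T : Set (EuclideanSpace ℝ (Fin d))) :
    (volume.restrict (S ×ˢ T) :
      Measure (EuclideanSpace ℝ (Fin d) × EuclideanSpace ℝ (Fin d)))
      = (volume.restrict S).prod (volume.restrict T) := (Measure.prod_restrict S T).symm

lemma aestronglyMeasurable_comp (hε : 0 < ε) {φ : EuclideanSpace ℝ (Fin d) → ℝ}
    (hφ : AEStronglyMeasurable φ (volume.restrict Ω)) {n : Fin d → ℤ} (hn : n ∈ Y.cells Ω ε) :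
    AEStronglyMeasurable (fun y => φ (ε • (Y.node n + y))) (volume.restrict Y.carrier) := by
  obtain ⟨hm, c, hc, -⟩ := Y.exists_map_eq hε n
  refine AEStronglyMeasurable.comp_measurable (g := φ) ?_ hm
  rw [hc]
  exact (hφ.mono_measure (Measure.restrict_mono_set _ hn)).smul_measure c

lemma measurableSet_cell (hε : 0 < ε) (n : Fin d → ℤ) :
    MeasurableSet (Y.scaled ε n Y.carrier ×ˢ Y.carrier) :=
  (Y.isOpen_scaled hε n).measurableSet.prod Y.isOpen.measurableSet

lemma aestronglyMeasurable_unfoldFun (hε : 0 < ε) {φ : EuclideanSpace ℝ (Fin d) → ℝ}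
    (hφ : AEStronglyMeasurable φ (volume.restrict Ω)) :
    AEStronglyMeasurable (Y.unfoldFun Ω ε φ) (volume.restrict (Ω ×ˢ Y.carrier)) := by
  have h : AEStronglyMeasurable (Y.unfoldFun Ω ε φ)
      (volume.restrict (⋃ n, Y.scaled ε n Y.carrier ×ˢ Y.carrier)) := by
    refine AEStronglyMeasurable.iUnion fun n => ?_
    by_cases hn : n ∈ Y.cells Ω ε
    · have h1 : AEStronglyMeasurable
          (fun p : EuclideanSpace ℝ (Fin d) × EuclideanSpace ℝ (Fin d) =>
            φ (ε • (Y.node n + p.2)))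
          (volume.restrict (Y.scaled ε n Y.carrier ×ˢ Y.carrier)) := by
        rw [restrict_prod_eq]
        exact (Y.aestronglyMeasurable_comp hε hφ hn).comp_snd
      refine h1.congr ?_
      filter_upwards [ae_restrict_mem (Y.measurableSet_cell hε n)] with p hp
      exact (Y.unfoldFun_eq hε hn φ hp.1).symm
    · refine (aestronglyMeasurable_const (b := (0 : ℝ))).congr ?_
      filter_upwards [ae_restrict_mem (Y.measurableSet_cell hε n)] with p hp
      exact (Y.unfoldFun_eq_zero hε hn φ hp.1).symm
  exact h.mono_measure (Measure.restrict_mono' (Y.ae_le_iUnion hε) le_rfl)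

lemma modular_unfoldFun_le (hε : 0 < ε) {φ : EuclideanSpace ℝ (Fin d) → ℝ}
    (hφ : AEStronglyMeasurable φ (volume.restrict Ω)) {δ : ℝ} (hδ : 0 ≤ δ) :
    modular B (volume.restrict (Ω ×ˢ Y.carrier)) δ (Y.unfoldFun Ω ε φ)
      ≤ volume Y.carrier * modular B (volume.restrict Ω) δ φ := by
  classical
  have hcell : ∀ n, modular B (volume.restrict (Y.scaled ε n Y.carrier ×ˢ Y.carrier)) δ
      (Y.unfoldFun Ω ε φ) ≤ volume Y.carrier *
        ∫⁻ x in (if n ∈ Y.cells Ω ε then Y.scaled ε n Y.carrier else ∅),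
          ENNReal.ofReal (B (δ * |φ x|)) := by
    intro n
    by_cases hn : n ∈ Y.cells Ω ε
    · have hae : Y.unfoldFun Ω ε φ
          =ᵐ[volume.restrict (Y.scaled ε n Y.carrier ×ˢ Y.carrier)]
          fun p => φ (ε • (Y.node n + p.2)) := by
        filter_upwards [ae_restrict_mem (Y.measurableSet_cell hε n)] with p hp
        exact Y.unfoldFun_eq hε hn φ hp.1
      rw [modular_congr hae, restrict_prod_eq, modular, if_pos hn]
      have hmeas := aemeasurable_modular (B := B) (Y.aestronglyMeasurable_comp hε hφ hn) hδ
      have h1 := lintegral_prod_mul (μ := volume.restrict (Y.scaled ε n Y.carrier))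
        (f := fun _ => 1) aemeasurable_const hmeas
      simp only [one_mul, lintegral_const, Measure.restrict_apply_univ] at h1
      rw [h1]
      obtain ⟨hm, c, hc, hvol⟩ := Y.exists_map_eq hε n
      have hφ' : AEStronglyMeasurable φ
          ((volume.restrict Y.carrier).map fun y => ε • (Y.node n + y)) := by
        rw [hc]
        exact (hφ.mono_measure (Measure.restrict_mono_set _ hn)).smul_measure c
      have h2 := lintegral_map' (aemeasurable_modular (B := B) hφ' hδ) hm.aemeasurable
      rw [← h2, hc, lintegral_smul_measure, smul_eq_mul, ← mul_assoc, hvol]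
    · have hae : Y.unfoldFun Ω ε φ
          =ᵐ[volume.restrict (Y.scaled ε n Y.carrier ×ˢ Y.carrier)] 0 := by
        filter_upwards [ae_restrict_mem (Y.measurableSet_cell hε n)] with p hp
        exact Y.unfoldFun_eq_zero hε hn φ hp.1
      rw [modular_congr hae, modular_zero]
      exact zero_le
  calc modular B (volume.restrict (Ω ×ˢ Y.carrier)) δ (Y.unfoldFun Ω ε φ)
      ≤ modular B (volume.restrict (⋃ n, Y.scaled ε n Y.carrier ×ˢ Y.carrier)) δ
          (Y.unfoldFun Ω ε φ) :=
        lintegral_mono' (Measure.restrict_mono' (Y.ae_le_iUnion hε) le_rfl) le_rfl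
    _ ≤ ∑' n, modular B (volume.restrict (Y.scaled ε n Y.carrier ×ˢ Y.carrier)) δ
          (Y.unfoldFun Ω ε φ) := lintegral_iUnion_le _ _
    _ ≤ ∑' n, volume Y.carrier *
          ∫⁻ x in (if n ∈ Y.cells Ω ε then Y.scaled ε n Y.carrier else ∅),
            ENNReal.ofReal (B (δ * |φ x|)) := ENNReal.tsum_le_tsum hcell
    _ = volume Y.carrier *
          ∫⁻ x in ⋃ n, (if n ∈ Y.cells Ω ε then Y.scaled ε n Y.carrier else ∅),
            ENNReal.ofReal (B (δ * |φ x|)) := by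
        rw [ENNReal.tsum_mul_left, lintegral_iUnion]
        · intro n
          split_ifs
          · exact (Y.isOpen_scaled hε n).measurableSet
          · exact MeasurableSet.empty
        · intro n m hnm
          simp only [Function.onFun]
          split_ifs
          · rw [Set.disjoint_iff_inter_eq_empty, ← Set.not_nonempty_iff_eq_empty]
            exact fun h => hnm (Y.eq_of_mem hε h)
          all_goals simp
    _ ≤ volume Y.carrier * modular B (volume.restrict Ω) δ φ := by
        gcongr
        refine lintegral_mono' (Measure.restrict_mono_set _ (iUnion_subset fun n => ?_)) le_rfl
        split_ifs with hn
        · exact hn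
        · exact empty_subset _

lemma memOrlicz_of_modular_le {α β : Type*} [MeasurableSpace α] [MeasurableSpace β]
    {μ : Measure α} {ν : Measure β} {f : α → ℝ} {g : β → ℝ} {C : ENNReal} (hC : C ≠ ⊤)
    (hf : MemOrlicz B μ f) (hg : AEStronglyMeasurable g ν)
    (h : ∀ δ : ℝ, 0 ≤ δ → modular B ν δ g ≤ C * modular B μ δ f) : MemOrlicz B ν g := by
  refine ⟨hg, ?_⟩
  have ht := ENNReal.Tendsto.const_mul hf.2 (Or.inr hC)
  rw [mul_zero] at ht
  refine tendsto_of_tendsto_of_tendsto_of_le_of_le' tendsto_const_nhds ht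
    (Eventually.of_forall fun _ => zero_le) ?_
  filter_upwards [self_mem_nhdsWithin] with δ hδ
  exact h δ (le_of_lt hδ)

lemma memOrlicz_unfoldFun (hε : 0 < ε) {φ : EuclideanSpace ℝ (Fin d) → ℝ}
    (hφ : MemOrlicz B (volume.restrict Ω) φ) :
    MemOrlicz B (volume.restrict (Ω ×ˢ Y.carrier)) (Y.unfoldFun Ω ε φ) :=
  memOrlicz_of_modular_le Y.volume_ne_top hφ (Y.aestronglyMeasurable_unfoldFun hε hφ.1)
    fun _ hδ => Y.modular_unfoldFun_le hε hφ.1 hδ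

lemma memOrlicz_fst {φ : EuclideanSpace ℝ (Fin d) → ℝ}
    (hφ : MemOrlicz B (volume.restrict Ω) φ) :
    MemOrlicz B (volume.restrict (Ω ×ˢ Y.carrier)) (fun p => φ p.1) := by
  rw [restrict_prod_eq]
  refine memOrlicz_of_modular_le Y.volume_ne_top hφ hφ.1.comp_fst fun δ hδ => ?_
  have h1 := lintegral_prod_mul (ν := volume.restrict Y.carrier)
    (aemeasurable_modular (B := B) hφ.1 hδ) (g := fun _ => 1) aemeasurable_const
  simp only [mul_one, lintegral_const, Measure.restrict_apply_univ, one_mul] at h1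
  rw [modular, h1, mul_comm]
  rfl

lemma memOrlicz_meanFun {w : EuclideanSpace ℝ (Fin d) × EuclideanSpace ℝ (Fin d) → ℝ}
    (hw : MemOrlicz B (volume.restrict (Ω ×ˢ Y.carrier)) w) :
    MemOrlicz B (volume.restrict Ω) (Y.meanFun w) := by
  rw [restrict_prod_eq] at hw
  have hne : volume Y.carrier ≠ 0 := by
    obtain ⟨z, n, hz, -⟩ := Y.paving.exists
    exact (Y.isOpen.measure_pos volume ⟨_, hz⟩).ne'
  have hint : AEStronglyMeasurable (fun x => ∫ y in Y.carrier, w (x, y)) (volume.restrict Ω) :=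
    hw.1.integral_prod_right'
  refine memOrlicz_of_modular_le (C := (volume Y.carrier)⁻¹) (ENNReal.inv_ne_top.2 hne) hw
    (hint.const_mul _) fun δ hδ => ?_
  rw [modular, modular, lintegral_prod _ (aemeasurable_modular hw.1 hδ),
    ← lintegral_const_mul' _ _ (ENNReal.inv_ne_top.2 hne)]
  refine lintegral_mono_ae ?_
  filter_upwards [hw.1.prodMk_left] with x hx
  have hmeas := aemeasurable_modular (B := B) hx hδ
  by_cases hfin : ∫⁻ y in Y.carrier, ENNReal.ofReal (B (δ * |w (x, y)|)) = ⊤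
  · rw [hfin, ENNReal.mul_top (ENNReal.inv_ne_zero.2 Y.volume_ne_top)]
    exact le_top
  by_cases hi : Integrable (fun y => w (x, y)) (volume.restrict Y.carrier)
  swap
  · simp [meanFun, integral_undef hi, B.map_zero]
  have hBi : Integrable (fun y => B (δ * |w (x, y)|)) (volume.restrict Y.carrier) := by
    refine (lintegral_ofReal_ne_top_iff_integrable
      ((B.continuous_abs hδ).comp_aestronglyMeasurable hx) ?_).1 hfin
    exact Eventually.of_forall fun y => B.nonneg (by positivity)
  have hI : Integrable (fun y => δ * |w (x, y)|) (volume.restrict Y.carrier) :=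
    hi.abs.const_mul δ
  have hJ := B.convexOn.map_set_average_le B.continuousOn isClosed_Ici hne Y.volume_ne_top
    (f := fun y => δ * |w (x, y)|)
    (Eventually.of_forall fun y => mul_nonneg hδ (abs_nonneg _)) hI hBi
  rw [setAverage_eq, setAverage_eq, smul_eq_mul, smul_eq_mul] at hJ
  have hle : δ * |Y.meanFun w x|
      ≤ (volume.real Y.carrier)⁻¹ * ∫ y in Y.carrier, δ * |w (x, y)| := by
    rw [meanFun, abs_mul, abs_of_nonneg (inv_nonneg.2 measureReal_nonneg),
      integral_const_mul, mul_left_comm]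
    gcongr
    exact abs_integral_le_integral_abs
  refine (ENNReal.ofReal_le_ofReal ((B.mono (by positivity) hle).trans hJ)).trans ?_
  rw [ENNReal.ofReal_mul (inv_nonneg.2 measureReal_nonneg), ofReal_integral_eq_lintegral_ofReal
    hBi (Eventually.of_forall fun y => B.nonneg (by positivity)), measureReal_def,
    ENNReal.ofReal_inv_of_pos (ENNReal.toReal_pos hne Y.volume_ne_top),
    ENNReal.ofReal_toReal Y.volume_ne_top]

/-- The unfolding operator `T_ε : L^B(Ω) → L^B(Ω × Y)`. -/
def unfolding (B : NFunction) (Ω : Set (EuclideanSpace ℝ (Fin d))) {ε : ℝ} (hε : 0 < ε)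
    (w : OrliczSpace B (volume.restrict Ω)) :
    OrliczSpace B (volume.restrict (Ω ×ˢ Y.carrier)) :=
  (Y.memOrlicz_unfoldFun hε w.2).toOrlicz

/-- A function `w ∈ L^B(Ω)`, seen as the element `(x, y) ↦ w x` of `L^B(Ω × Y)`. -/
def lift (w : OrliczSpace B (volume.restrict Ω)) :
    OrliczSpace B (volume.restrict (Ω ×ˢ Y.carrier)) := (Y.memOrlicz_fst w.2).toOrlicz

/-- The mean value operator `M_Y : L^B(Ω × Y) → L^B(Ω)`. -/
def mean (w : OrliczSpace B (volume.restrict (Ω ×ˢ Y.carrier))) :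
    OrliczSpace B (volume.restrict Ω) := (Y.memOrlicz_meanFun w.2).toOrlicz

end RefCell

/-! ### Weak convergence -/

section Weak

variable {E : Type*} [NormedAddCommGroup E] [NormedSpace ℝ E]

/-- Weak convergence of a sequence in a normed space. -/
def WeaklyTendsto (u : ℕ → E) (v : E) : Prop :=
  Tendsto (fun n => toWeakSpace ℝ E (u n)) atTop (𝓝 (toWeakSpace ℝ E v))

/-- The set of members of the sequence has compact closure in the weak topology. -/
def RelWeaklyCompact (u : ℕ → E) : Prop :=
  IsCompact (closure (range fun n => toWeakSpace ℝ E (u n)))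

end Weak

end Unfolding

end

/-!
The unfolding operator is bounded, `‖T_ε w‖ ≤ (1 + |Y|) ‖w‖`, because it multiplies the modular by
at most `|Y|` and the modular is convex. Everything rests on this bound and on two facts about
`L^B` over a finite measure space under `Δ₂` and `∇₂`.

*Duality.* A continuous functional on `L^B` induces a functional on bounded measurable functions
which is `L¹`-continuous on uniformly bounded sets, hence has a Radon–Nikodym density `g`
(`IsL1Continuous.exists_density`). Testing with selections of finitely many of the affine functions
whose supremum is the complementary function `B~` shows `∫ B~(|g| / L) ≤ 1`
(`exists_representation`). By Young's inequality and `Δ₂` for `B~`, bounded densities are therefore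
dense in the dual (`exists_norm_sub_pairing_le`). The same argument, applied to an element of the
bidual restricted to bounded densities and with `B` in place of `B~`, produces an element of `L^B`,
so `L^B` is reflexive (`exists_eq_eval`) and its bounded sequences are relatively weakly compact.

*Density and uniform integrability.* Bounded continuous functions are dense in `L^B`
(`exists_continuous_norm_sub_lt`), and bounded sets of `L^B` are uniformly integrable since `B` is
superlinear (`exists_integral_abs_mul_le`).

For a bounded continuous function the unfoldings converge almost everywhere and boundedly; density
and the bound on `T_ε` give strong convergence for all functions, and for strongly convergent
sequences. A relatively weakly compact sequence is bounded, so its unfoldings are bounded and hence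
relatively weakly compact by reflexivity. For the weak limit of the means, `T_ε` satisfies
`∫ T_ε h T_ε w = |Y| ∫ h w`, the integral on the right being over the cells inside `Ω`
(`integral_unfoldFun`); uniform integrability allows one to replace `T_ε h` by `h` and to neglect
the boundary layer, which proves the claim for bounded `h` (`tendsto_pairing`), and these are dense
in the dual. The last inequality is weak lower semicontinuity of the norm combined with the bound
on `T_ε`.
-/

open MeasureTheory Filter Topology Set

noncomputable section

namespace Unfolding

/-! ### Growth of N-functions -/

namespace NFunction

variable (B : NFunction)

/-- Superlinear growth: the identity is dominated by any small multiple of `B` plus a constant.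
This is where uniform integrability of modular-bounded families comes from. -/
lemma exists_le_mul_add {η : ℝ} (hη : 0 < η) :
    ∃ C : ℝ, 0 ≤ C ∧ ∀ t, 0 ≤ t → t ≤ η * B t + C := by
  obtain ⟨T, hT⟩ := eventually_atTop.1 (B.tendsto_div_atTop.eventually_ge_atTop η⁻¹)
  refine ⟨max T 1, by positivity, fun t ht => ?_⟩
  have hB := B.nonneg ht
  rcases le_total t (max T 1) with h | h
  · have := mul_nonneg hη.le hB
    linarith
  · have ht0 : 0 < t := lt_of_lt_of_le (by positivity) h
    have h1 := hT t ((le_max_left _ _).trans h)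
    rw [le_div_iff₀ ht0, inv_mul_le_iff₀ hη] at h1
    have : (0 : ℝ) ≤ max T 1 := by positivity
    linarith

lemma bddAbove_conjugate (t : ℝ) : BddAbove ((fun s => s * t - B s) '' Ici 0) := by
  obtain ⟨C, hC0, hC⟩ := B.exists_le_mul_add (η := (|t| + 1)⁻¹) (by positivity)
  refine ⟨C * (|t| + 1), ?_⟩
  rintro _ ⟨s, hs, rfl⟩
  have hs : 0 ≤ s := hs
  have h1 := mul_le_mul_of_nonneg_right (hC s hs) (by positivity : (0 : ℝ) ≤ |t| + 1)
  have h2 : ((|t| + 1)⁻¹ * B s + C) * (|t| + 1) = B s + C * (|t| + 1) := by field_simp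
  have h3 : s * t ≤ s * |t| := mul_le_mul_of_nonneg_left (le_abs_self t) hs
  simp only
  nlinarith

/-- Young's inequality. -/
lemma mul_le_add_conjugate {s : ℝ} (hs : 0 ≤ s) (t : ℝ) : s * t ≤ B s + conjugate B t := by
  have := le_csSup (B.bddAbove_conjugate t) ⟨s, hs, rfl⟩
  simp only at this
  rw [conjugate]
  linarith

lemma conjugate_nonneg (t : ℝ) : 0 ≤ conjugate B t := by
  have := B.mul_le_add_conjugate le_rfl t
  rw [B.map_zero] at this
  linarith

lemma conjugate_mono {s t : ℝ} (h : s ≤ t) : conjugate B s ≤ conjugate B t := by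
  refine csSup_le (image_nonempty.2 ⟨0, self_mem_Ici⟩) ?_
  rintro _ ⟨r, hr, rfl⟩
  have h1 := B.mul_le_add_conjugate hr t
  have h2 : r * s ≤ r * t := mul_le_mul_of_nonneg_left h hr
  simp only
  linarith

lemma convexOn_abs : ConvexOn ℝ univ fun t : ℝ => B |t| := by
  refine ⟨convex_univ, fun x _ y _ a b ha hb hab => ?_⟩
  refine le_trans (B.mono (abs_nonneg _) ?_)
    (B.convexOn.2 (abs_nonneg x) (abs_nonneg y) ha hb hab)
  simp only [smul_eq_mul]
  refine (abs_add_le _ _).trans_eq ?_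
  rw [abs_mul, abs_mul, abs_of_nonneg ha, abs_of_nonneg hb]

end NFunction

/-- Iterating the doubling condition, which holds for large arguments only, bounds every dilation
up to an additive constant. -/
lemma DeltaTwo.exists_le {Φ : ℝ → ℝ} (hΦ : DeltaTwo Φ) (h0 : ∀ t, 0 ≤ t → 0 ≤ Φ t)
    (hm : ∀ s t, 0 ≤ s → s ≤ t → Φ s ≤ Φ t) {K : ℝ} (hK : 0 ≤ K) :
    ∃ a b : ℝ, 0 ≤ a ∧ 0 ≤ b ∧ ∀ t, 0 ≤ t → Φ (K * t) ≤ a * Φ t + b := by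
  obtain ⟨α, hα, t₀, ht₀, h⟩ := hΦ
  have key : ∀ k : ℕ, ∃ a b : ℝ, 0 ≤ a ∧ 0 ≤ b ∧ ∀ t, 0 ≤ t → Φ (2 ^ k * t) ≤ a * Φ t + b := by
    intro k
    induction k with
    | zero => exact ⟨1, 0, by simp, by simp, fun t _ => by simp⟩
    | succ k ih =>
      obtain ⟨a, b, ha, hb, hk⟩ := ih
      refine ⟨α * a, α * b + Φ (2 * t₀), by positivity,
        add_nonneg (by positivity) (h0 _ (by positivity)), fun t ht => ?_⟩
      have e : (2 : ℝ) ^ (k + 1) * t = 2 * (2 ^ k * t) := by ring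
      have hp : 0 ≤ 2 ^ k * t := by positivity
      have h2 := h0 (2 * t₀) (by positivity)
      rw [e]
      rcases le_total t₀ (2 ^ k * t) with hle | hle
      · have h3 := mul_le_mul_of_nonneg_left (hk t ht) hα.le
        linarith [h _ hle]
      · have h4 := hm (2 * (2 ^ k * t)) (2 * t₀) (by positivity) (by linarith)
        have h5 := mul_nonneg (mul_nonneg hα.le ha) (h0 t ht)
        have h6 := mul_nonneg hα.le hb
        linarith
  obtain ⟨k, hk⟩ := pow_unbounded_of_one_lt K (one_lt_two : (1 : ℝ) < 2)
  obtain ⟨a, b, ha, hb, hab⟩ := key k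
  exact ⟨a, b, ha, hb, fun t ht =>
    (hm _ _ (by positivity) (mul_le_mul_of_nonneg_right hk.le ht)).trans (hab t ht)⟩

/-! ### Modular and Luxemburg norm on finite measure spaces -/

section Modular

variable {α : Type*} [MeasurableSpace α] {B : NFunction} {ν : Measure α}

lemma luxemburgNorm_le {k : ℝ} (hk : 0 < k) {f : α → ℝ} (h : modular B ν k⁻¹ f ≤ 1) :
    luxemburgNorm B ν f ≤ k := by
  rw [luxemburgNorm_eq]
  exact csInf_le (bddBelow_luxemburg f) ⟨hk, h⟩

lemma modular_mono_left {δ δ' : ℝ} (hδ : 0 ≤ δ) (h : δ ≤ δ') (f : α → ℝ) :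
    modular B ν δ f ≤ modular B ν δ' f :=
  lintegral_mono fun x => ENNReal.ofReal_le_ofReal
    (B.mono (by positivity) (mul_le_mul_of_nonneg_right h (abs_nonneg _)))

lemma MemOrlicz.modular_le_one {k : ℝ} {f : α → ℝ} (hf : MemOrlicz B ν f)
    (h : luxemburgNorm B ν f < k) : modular B ν k⁻¹ f ≤ 1 := by
  rw [luxemburgNorm_eq] at h
  obtain ⟨l, ⟨hl0, hl⟩, hlk⟩ := exists_lt_of_csInf_lt hf.exists_le_one h
  have hk : 0 < k := hl0.trans hlk
  exact (modular_mono_left (inv_pos.2 hk).le (inv_anti₀ hl0 hlk.le) f).trans hl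

lemma OrliczSpace.coeFn_sub (f g : OrliczSpace B ν) :
    ((f - g : OrliczSpace B ν) : α →ₘ[ν] ℝ)
      =ᵐ[ν] fun x => (f : α →ₘ[ν] ℝ) x - (g : α →ₘ[ν] ℝ) x :=
  AEEqFun.coeFn_sub (f : α →ₘ[ν] ℝ) (g : α →ₘ[ν] ℝ)

/-- Modular convergence at every scale implies norm convergence. -/
lemma tendsto_of_modular_le {ι : Type*} {l : Filter ι} {u : ι → OrliczSpace B ν}
    {v : OrliczSpace B ν}
    (h : ∀ k : ℝ, 0 < k → ∀ᶠ n in l, modular B ν k⁻¹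
      (fun x => (u n : α →ₘ[ν] ℝ) x - (v : α →ₘ[ν] ℝ) x) ≤ 1) : Tendsto u l (𝓝 v) := by
  rw [tendsto_iff_norm_sub_tendsto_zero]
  refine Metric.tendsto_nhds.2 fun η hη => ?_
  filter_upwards [h (η / 2) (by positivity)] with n hn
  rw [Real.dist_eq, sub_zero, abs_norm, norm_def, luxemburgNorm_congr (OrliczSpace.coeFn_sub _ _)]
  exact (luxemburgNorm_le (by positivity) hn).trans_lt (by linarith)

/-- Under `Δ₂` the modular is finite at every scale. -/
lemma MemOrlicz.modular_ne_top [IsFiniteMeasure ν] (hB : DeltaTwo B) {f : α → ℝ}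
    (hf : MemOrlicz B ν f) {δ : ℝ} (hδ : 0 ≤ δ) : modular B ν δ f ≠ ⊤ := by
  obtain ⟨k, hk, hk1⟩ := hf.exists_le_one
  obtain ⟨a, b, ha, hb, hab⟩ := hB.exists_le (fun t => B.nonneg) (fun s t => B.mono)
    (K := δ * k) (by positivity)
  have hle : modular B ν δ f ≤ ENNReal.ofReal a * modular B ν k⁻¹ f
      + ENNReal.ofReal b * ν univ := by
    rw [modular, modular, ← lintegral_const, ← lintegral_const_mul' _ _ ENNReal.ofReal_ne_top,
      ← lintegral_add_right _ measurable_const]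
    refine lintegral_mono fun x => ?_
    have hx : 0 ≤ k⁻¹ * |f x| := by positivity
    rw [← ENNReal.ofReal_mul ha, ← ENNReal.ofReal_add (mul_nonneg ha (B.nonneg hx)) hb]
    refine ENNReal.ofReal_le_ofReal ?_
    have := hab _ hx
    rwa [mul_assoc, mul_inv_cancel_left₀ hk.ne'] at this
  refine ne_top_of_le_ne_top (ENNReal.add_ne_top.2 ⟨ENNReal.mul_ne_top ENNReal.ofReal_ne_top
    (ne_top_of_le_ne_top ENNReal.one_ne_top hk1), ENNReal.mul_ne_top ENNReal.ofReal_ne_top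
    (measure_ne_top _ _)⟩) hle

lemma integrable_modular {f : α → ℝ}
    (hf : AEStronglyMeasurable f ν) {δ : ℝ} (hδ : 0 ≤ δ) (h : modular B ν δ f ≠ ⊤) :
    Integrable (fun x => B (δ * |f x|)) ν :=
  (lintegral_ofReal_ne_top_iff_integrable
      ((B.continuous_abs hδ).comp_aestronglyMeasurable hf)
      (Eventually.of_forall fun y => B.nonneg (by positivity))).1 h

lemma integrable_of_modular_ne_top [IsFiniteMeasure ν] {f : α → ℝ}
    (hf : AEStronglyMeasurable f ν) {δ : ℝ} (hδ : 0 < δ) (h : modular B ν δ f ≠ ⊤) :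
    Integrable f ν := by
  obtain ⟨C, hC0, hC⟩ := B.exists_le_mul_add (η := 1) one_pos
  have hBi := integrable_modular hf hδ.le h
  refine ((hBi.add (integrable_const C)).const_mul δ⁻¹).mono' hf (Eventually.of_forall fun x => ?_)
  have := hC (δ * |f x|) (by positivity)
  rw [Real.norm_eq_abs, le_inv_mul_iff₀ hδ]
  simpa using this

lemma integral_modular_le {f : α → ℝ}
    (hf : AEStronglyMeasurable f ν) {δ : ℝ} (hδ : 0 ≤ δ) (h : modular B ν δ f ≤ 1) :
    ∫ x, B (δ * |f x|) ∂ν ≤ 1 := by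
  rw [integral_eq_lintegral_of_nonneg_ae (Eventually.of_forall fun y => B.nonneg (by positivity))
    ((B.continuous_abs hδ).comp_aestronglyMeasurable hf)]
  exact ENNReal.toReal_le_of_le_ofReal zero_le_one (by simpa [modular] using h)

lemma MemOrlicz.integrable [IsFiniteMeasure ν] {f : α → ℝ} (hf : MemOrlicz B ν f) :
    Integrable f ν := by
  obtain ⟨k, hk, hk1⟩ := hf.exists_le_one
  exact integrable_of_modular_ne_top hf.1 (inv_pos.2 hk)
    (ne_top_of_le_ne_top ENNReal.one_ne_top hk1)

/-- On functions bounded by `M`, the modular is controlled by the `L¹` norm. -/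
lemma modular_le_of_abs_le {f : α → ℝ} {M δ : ℝ} (hM : 0 < M) (hδ : 0 ≤ δ)
    (hf : Integrable f ν) (hfM : ∀ᵐ x ∂ν, |f x| ≤ M) :
    modular B ν δ f ≤ ENNReal.ofReal (B (δ * M) / M * ∫ x, |f x| ∂ν) := by
  rw [← integral_const_mul, ofReal_integral_eq_lintegral_ofReal (hf.abs.const_mul _)
    (Eventually.of_forall fun x => mul_nonneg (div_nonneg (B.nonneg (by positivity)) hM.le)
      (abs_nonneg _))]
  refine lintegral_mono_ae ?_
  filter_upwards [hfM] with x hx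
  refine ENNReal.ofReal_le_ofReal ?_
  have := B.map_mul_le (c := |f x| / M) (t := δ * M) (by positivity) ((div_le_one hM).2 hx)
    (by positivity)
  have e : |f x| / M * (δ * M) = δ * |f x| := by field_simp
  rw [e] at this
  exact this.trans_eq (by ring)

lemma memOrlicz_of_abs_le [IsFiniteMeasure ν] {f : α → ℝ} (hf : AEStronglyMeasurable f ν)
    {M : ℝ} (hfM : ∀ᵐ x ∂ν, |f x| ≤ M) : MemOrlicz B ν f := by
  refine ⟨hf, ?_⟩
  have hfM' : ∀ᵐ x ∂ν, |f x| ≤ max M 1 := hfM.mono fun x hx => hx.trans (le_max_left _ _)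
  have hM : (0 : ℝ) < max M 1 := by positivity
  have hi : Integrable f ν := (integrable_const (max M 1)).mono' hf hfM'
  have ht : Tendsto (fun δ : ℝ => ENNReal.ofReal
      (B (δ * max M 1) / max M 1 * ∫ x, |f x| ∂ν)) (𝓝[>] 0) (𝓝 0) := by
    have h1 : Tendsto (fun δ : ℝ => B (δ * max M 1)) (𝓝[>] 0) (𝓝 0) := by
      have h2 : Tendsto B (𝓝[>] 0) (𝓝 (B 0)) :=
        (B.continuousOn 0 self_mem_Ici).mono_left (nhdsWithin_mono _ Ioi_subset_Ici_self)
      rw [B.map_zero] at h2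
      exact h2.comp (tendsto_mul_nhdsGT hM)
    have h3 := ENNReal.tendsto_ofReal ((h1.div_const (max M 1)).mul_const (∫ x, |f x| ∂ν))
    simpa using h3
  refine tendsto_of_tendsto_of_tendsto_of_le_of_le' tendsto_const_nhds ht
    (Eventually.of_forall fun _ => zero_le) ?_
  filter_upwards [self_mem_nhdsWithin] with δ hδ
  exact modular_le_of_abs_le hM (le_of_lt hδ) hi hfM'

/-- Uniform integrability of the unit ball of the modular: the pairing with functions bounded by
`M` is small, uniformly on the ball, when their `L¹` norm is. -/
lemma exists_integral_abs_mul_le (B : NFunction) {M η : ℝ} (hM : 0 ≤ M) (hη : 0 < η) :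
    ∃ C : ℝ, 0 ≤ C ∧ ∀ (f h : α → ℝ) (k : ℝ), 0 < k → AEStronglyMeasurable f ν →
      modular B ν k⁻¹ f ≤ 1 → Integrable h ν → (∀ᵐ x ∂ν, |h x| ≤ M) →
      ∫ x, |f x * h x| ∂ν ≤ k * (η + C * ∫ x, |h x| ∂ν) := by
  obtain ⟨C, hC0, hC⟩ := B.exists_le_mul_add (η := η / (M + 1)) (by positivity)
  refine ⟨C, hC0, fun f h k hk hf hfk hh hhM => ?_⟩
  have hk' : 0 ≤ k⁻¹ := (inv_pos.2 hk).le
  have hBi := integrable_modular hf hk' (ne_top_of_le_ne_top ENNReal.one_ne_top hfk)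
  have hB1 := integral_modular_le hf hk' hfk
  have hle : ∫ x, |f x * h x| ∂ν ≤ ∫ x, k * (η * B (k⁻¹ * |f x|) + C * |h x|) ∂ν := by
    refine integral_mono_of_nonneg (Eventually.of_forall fun x => abs_nonneg _)
      (((hBi.const_mul η).add (hh.abs.const_mul C)).const_mul k) ?_
    filter_upwards [hhM] with x hx
    have hx0 : 0 ≤ k⁻¹ * |f x| := by positivity
    have h1 := mul_le_mul_of_nonneg_right (hC _ hx0) (abs_nonneg (h x))
    have hb := B.nonneg hx0
    have h2 : η / (M + 1) * B (k⁻¹ * |f x|) * |h x| ≤ η * B (k⁻¹ * |f x|) := by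
      rw [mul_right_comm]
      refine mul_le_mul_of_nonneg_right ?_ hb
      rw [div_mul_eq_mul_div, div_le_iff₀ (by positivity)]
      exact mul_le_mul_of_nonneg_left (by linarith) hη.le
    have e : |f x * h x| = k * (k⁻¹ * |f x| * |h x|) := by
      rw [abs_mul]; field_simp
    rw [e]
    refine mul_le_mul_of_nonneg_left ?_ hk.le
    linarith
  refine hle.trans ?_
  rw [integral_const_mul, integral_add (hBi.const_mul η) (hh.abs.const_mul C),
    integral_const_mul, integral_const_mul]
  refine mul_le_mul_of_nonneg_left ?_ hk.le
  have := mul_le_mul_of_nonneg_left hB1 hη.le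
  linarith

end Modular

/-! ### Functionals on bounded measurable functions -/

section Density

variable {α : Type*} [MeasurableSpace α]

variable (α) in
/-- The space of bounded measurable real functions (genuine functions, not classes), on which
elements of the dual and of the bidual of an Orlicz space are tested. -/
def bddMeasurable : Submodule ℝ (α → ℝ) where
  carrier := {f | Measurable f ∧ ∃ C : ℝ, ∀ x, |f x| ≤ C}
  add_mem' := by
    rintro f g ⟨hf, C, hC⟩ ⟨hg, D, hD⟩
    exact ⟨hf.add hg, C + D, fun x => (abs_add_le _ _).trans (add_le_add (hC x) (hD x))⟩
  zero_mem' := ⟨measurable_const, 0, fun x => by simp⟩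
  smul_mem' := by
    rintro c f ⟨hf, C, hC⟩
    refine ⟨hf.const_smul c, |c| * C, fun x => ?_⟩
    rw [Pi.smul_apply, smul_eq_mul, abs_mul]
    exact mul_le_mul_of_nonneg_left (hC x) (abs_nonneg c)

lemma indicator_mem_bddMeasurable {A : Set α} (hA : MeasurableSet A) (c : ℝ) :
    A.indicator (fun _ => c) ∈ bddMeasurable α := by
  refine ⟨measurable_const.indicator hA, |c|, fun x => ?_⟩
  by_cases hx : x ∈ A <;> simp [hx]

lemma simpleFunc_mem_bddMeasurable (f : SimpleFunc α ℝ) : (f : α → ℝ) ∈ bddMeasurable α := by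
  obtain ⟨C, hC⟩ := f.exists_forall_norm_le
  exact ⟨f.measurable, C, hC⟩

lemma integrable_of_mem_bddMeasurable {ν : Measure α} [IsFiniteMeasure ν] {f : α → ℝ}
    (hf : f ∈ bddMeasurable α) : Integrable f ν := by
  obtain ⟨hm, C, hC⟩ := hf
  exact (integrable_const C).mono' hm.aestronglyMeasurable (Eventually.of_forall hC)

lemma integrable_mul_of_mem_bddMeasurable {ν : Measure α} {f g : α → ℝ}
    (hf : f ∈ bddMeasurable α) (hg : Integrable g ν) : Integrable (fun x => f x * g x) ν := by
  obtain ⟨hm, C, hC⟩ := hf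
  exact hg.bdd_mul hm.aestronglyMeasurable (Eventually.of_forall hC)

open Classical in
/-- The truncation of `g` to the set where `|g| ≤ N`, by zero elsewhere. -/
def trunc {β : Type*} (g : β → ℝ) (N : ℕ) (x : β) : ℝ := if |g x| ≤ N then g x else 0

lemma trunc_mem_bddMeasurable {g : α → ℝ} (hg : Measurable g) (N : ℕ) :
    trunc g N ∈ bddMeasurable α := by
  refine ⟨Measurable.ite (measurableSet_le hg.abs measurable_const) hg measurable_const, N,
    fun x => ?_⟩
  unfold trunc
  split_ifs with h
  · exact h
  · simp

lemma abs_trunc_le {β : Type*} (g : β → ℝ) (N : ℕ) (x : β) : |trunc g N x| ≤ |g x| := by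
  unfold trunc
  split_ifs <;> simp

lemma trunc_eventually_eq {β : Type*} (g : β → ℝ) (x : β) :
    ∀ᶠ N : ℕ in atTop, trunc g N x = g x := by
  obtain ⟨N, hN⟩ := exists_nat_ge |g x|
  filter_upwards [eventually_ge_atTop N] with n hn
  exact if_pos (hN.trans (by exact_mod_cast hn))

/-- A linear functional on bounded measurable functions which, on uniformly bounded functions, is
continuous for the `L¹` norm. -/
def IsL1Continuous (ν : Measure α) (Λ : bddMeasurable α →ₗ[ℝ] ℝ) : Prop :=
  ∀ M η : ℝ, 0 < M → 0 < η → ∃ δ : ℝ, 0 < δ ∧ ∀ h : bddMeasurable α, (∀ x, |h.1 x| ≤ M) →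
    ∫ x, |h.1 x| ∂ν ≤ δ → |Λ h| ≤ η

variable {ν : Measure α} [IsFiniteMeasure ν] {Λ : bddMeasurable α →ₗ[ℝ] ℝ}

/-- Bounded pointwise convergence. -/
lemma IsL1Continuous.tendsto (hΛ : IsL1Continuous ν Λ) {ι : Type*} {l : Filter ι}
    [l.IsCountablyGenerated] {u : ι → bddMeasurable α} {v : bddMeasurable α} {M : ℝ}
    (hM : ∀ i x, |(u i).1 x| ≤ M) (h : ∀ x, Tendsto (fun i => (u i).1 x) l (𝓝 (v.1 x))) :
    Tendsto (fun i => Λ (u i)) l (𝓝 (Λ v)) := by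
  obtain ⟨C, hC⟩ := v.2.2
  have hL : Tendsto (fun i => ∫ x, |(u i).1 x - v.1 x| ∂ν) l (𝓝 (∫ _, 0 ∂ν)) := by
    refine tendsto_integral_filter_of_dominated_convergence (fun _ => M + C)
      (Eventually.of_forall fun i => ((u i).2.1.sub v.2.1).abs.aestronglyMeasurable)
      (Eventually.of_forall fun i => Eventually.of_forall fun x => ?_) (integrable_const _)
      (Eventually.of_forall fun x => ?_)
    · rw [Real.norm_eq_abs, abs_abs]
      exact (abs_sub _ _).trans (add_le_add (hM i x) (hC x))
    · simpa using ((h x).sub_const (v.1 x)).abs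
  rw [integral_zero] at hL
  refine Metric.tendsto_nhds.2 fun η hη => ?_
  obtain ⟨δ, hδ, H⟩ := hΛ (max (M + C) 1) (η / 2) (by positivity) (by positivity)
  filter_upwards [hL.eventually_le_const hδ] with i hi
  rw [Real.dist_eq, ← map_sub]
  refine (H (u i - v) (fun x => ?_) hi).trans_lt (by linarith)
  exact (abs_sub _ _).trans ((add_le_add (hM i x) (hC x)).trans (le_max_left _ _))

open Classical in
/-- The signed measure `A ↦ Λ 1_A`. -/
def IsL1Continuous.signedMeasure (hΛ : IsL1Continuous ν Λ) : SignedMeasure α where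
  measureOf' A := if hA : MeasurableSet A then Λ ⟨_, indicator_mem_bddMeasurable hA 1⟩ else 0
  empty' := by
    rw [dif_pos MeasurableSet.empty]
    convert Λ.map_zero
    ext x
    simp
  not_measurable' A hA := dif_neg hA
  m_iUnion' A hA hd := by
    have hU := MeasurableSet.iUnion hA
    simp only [hA, hU, dite_true]
    have e : ∀ (s : Finset ℕ) (x : α),
        ((∑ i ∈ s, ⟨_, indicator_mem_bddMeasurable (hA i) 1⟩ : bddMeasurable α) : α → ℝ) x
          = (⋃ i ∈ s, A i).indicator (fun _ => (1 : ℝ)) x := by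
      intro s x
      rw [AddSubmonoidClass.coe_finsetSum, Finset.sum_apply,
        Finset.indicator_biUnion_apply s A (fun i _ j _ hij => hd hij)]
    refine (hΛ.tendsto (M := 1) (l := atTop)
      (u := fun s : Finset ℕ => ∑ i ∈ s, ⟨_, indicator_mem_bddMeasurable (hA i) 1⟩)
      (v := ⟨_, indicator_mem_bddMeasurable hU 1⟩) (fun s x => ?_) fun x => ?_).congr fun s => ?_
    · rw [e]
      by_cases hx : x ∈ ⋃ i ∈ s, A i <;> simp only [indicator, hx] <;> simp
    · simp only [e]
      by_cases hx : x ∈ ⋃ i, A i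
      · obtain ⟨i, hi⟩ := mem_iUnion.1 hx
        refine tendsto_const_nhds.congr' ?_
        filter_upwards [eventually_ge_atTop {i}] with s hs
        rw [indicator_of_mem hx, indicator_of_mem]
        exact mem_biUnion (hs (Finset.mem_singleton_self i)) hi
      · refine tendsto_const_nhds.congr fun s => ?_
        rw [indicator_of_notMem hx, indicator_of_notMem]
        exact fun h => hx (iUnion₂_subset (fun i _ => subset_iUnion A i) h)
    · exact map_sum _ _ _

lemma IsL1Continuous.signedMeasure_apply (hΛ : IsL1Continuous ν Λ) {A : Set α}
    (hA : MeasurableSet A) :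
    hΛ.signedMeasure A = Λ ⟨_, indicator_mem_bddMeasurable hA 1⟩ := dif_pos hA

/-- The Radon–Nikodym theorem for functionals. -/
lemma IsL1Continuous.exists_density (hΛ : IsL1Continuous ν Λ) :
    ∃ g : α → ℝ, Measurable g ∧ Integrable g ν ∧ ∀ h, Λ h = ∫ x, h.1 x * g x ∂ν := by
  have hac : hΛ.signedMeasure ≪ᵥ ν.toENNRealVectorMeasure := by
    refine VectorMeasure.AbsolutelyContinuous.mk fun A hA h0 => ?_
    rw [Measure.toENNRealVectorMeasure_apply_measurable hA] at h0
    rw [hΛ.signedMeasure_apply hA]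
    refine abs_eq_zero.1 (le_antisymm (le_of_forall_pos_le_add fun η hη => ?_) (abs_nonneg _))
    obtain ⟨δ, hδ, H⟩ := hΛ 1 η one_pos hη
    rw [zero_add]
    refine H _ (fun x => ?_) (le_of_eq_of_le ?_ hδ.le)
    · by_cases hx : x ∈ A <;> simp [hx]
    · refine integral_eq_zero_of_ae ?_
      filter_upwards [measure_eq_zero_iff_ae_notMem.1 h0] with x hx
      simp [hx]
  have hrn := hΛ.signedMeasure.withDensityᵥ_rnDeriv_eq ν hac
  have hgi : Integrable (hΛ.signedMeasure.rnDeriv ν) ν := SignedMeasure.integrable_rnDeriv _ _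
  have hgm : Measurable (hΛ.signedMeasure.rnDeriv ν) := SignedMeasure.measurable_rnDeriv _ _
  generalize hΛ.signedMeasure.rnDeriv ν = g at hrn hgi hgm
  refine ⟨g, hgm, hgi, ?_⟩
  have hind : ∀ (A : Set α) (hA : MeasurableSet A),
      Λ ⟨_, indicator_mem_bddMeasurable hA 1⟩ = ∫ x in A, g x ∂ν := by
    intro A hA
    rw [← withDensityᵥ_apply hgi hA, hrn, hΛ.signedMeasure_apply hA]
  have hsimple : ∀ f : SimpleFunc α ℝ,
      Λ ⟨f, simpleFunc_mem_bddMeasurable f⟩ = ∫ x, f x * g x ∂ν := by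
    intro f
    induction f using SimpleFunc.induction with
    | const c hA =>
      rename_i A
      have e : (⟨_, simpleFunc_mem_bddMeasurable (SimpleFunc.piecewise A hA
          (SimpleFunc.const α c) (SimpleFunc.const α 0))⟩ : bddMeasurable α)
          = c • ⟨_, indicator_mem_bddMeasurable hA 1⟩ := by
        ext x
        by_cases hx : x ∈ A <;> simp [hx]
      rw [e, map_smul, hind A hA, smul_eq_mul, ← integral_const_mul, ← integral_indicator hA]
      congr 1 with x
      by_cases hx : x ∈ A <;> simp [hx]
    | add hd hf hg' =>
      rename_i f f'
      have e : (⟨_, simpleFunc_mem_bddMeasurable (f + f')⟩ : bddMeasurable α)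
          = ⟨_, simpleFunc_mem_bddMeasurable f⟩ + ⟨_, simpleFunc_mem_bddMeasurable f'⟩ := rfl
      rw [e, map_add, hf, hg', ← integral_add
        (integrable_mul_of_mem_bddMeasurable (simpleFunc_mem_bddMeasurable f) hgi)
        (integrable_mul_of_mem_bddMeasurable (simpleFunc_mem_bddMeasurable f') hgi)]
      congr 1 with x
      simp [add_mul]
  rintro ⟨h, hm, C, hC⟩
  have hC' : ∀ x, ‖h x‖ ≤ max C 0 := fun x => (hC x).trans (le_max_left _ _)
  have hs := hm.stronglyMeasurable
  have h1 : ∀ x, Tendsto (fun n => hs.approxBounded (max C 0) n x) atTop (𝓝 (h x)) := fun x =>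
    hs.tendsto_approxBounded_of_norm_le (hC' x)
  have h2 : ∀ n x, ‖hs.approxBounded (max C 0) n x‖ ≤ max C 0 := fun n x =>
    hs.norm_approxBounded_le (le_max_right _ _) n x
  refine tendsto_nhds_unique (hΛ.tendsto
    (u := fun n => ⟨_, simpleFunc_mem_bddMeasurable (hs.approxBounded (max C 0) n)⟩)
    (v := ⟨h, hm, C, hC⟩) h2 h1) ?_
  simp only [hsimple]
  refine tendsto_integral_of_dominated_convergence (fun x => max C 0 * |g x|)
    (fun n => ((hs.approxBounded (max C 0) n).measurable.mul hgm).aestronglyMeasurable)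
    (hgi.abs.const_mul _) (fun n => Eventually.of_forall fun x => ?_)
    (Eventually.of_forall fun x => (h1 x).mul_const _)
  rw [norm_mul]
  exact mul_le_mul_of_nonneg_right (h2 n x) (abs_nonneg _)

/-- To bound `∫ Φ (g)` for a countable supremum `Φ` of affine functions, it suffices to test with
measurable selections of finitely many of them. -/
lemma lintegral_le_one_of_affine {Φ : ℝ → ℝ} {a b : ℕ → ℝ} (ha : a 0 = 0) (hb : b 0 = 0)
    (hΦ : ∀ t c, c < Φ t → ∃ i, c < a i * t + b i) {g : α → ℝ} (hg : Measurable g)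
    (hgi : Integrable g ν)
    (H : ∀ i : α → ℕ, (fun x => a (i x)) ∈ bddMeasurable α → (fun x => b (i x)) ∈ bddMeasurable α →
      ∫ x, (a (i x) * g x + b (i x)) ∂ν ≤ 1) :
    ∫⁻ x, ENNReal.ofReal (Φ (g x)) ∂ν ≤ 1 := by
  have hbdd : ∀ (c : ℕ → ℝ) (i : α → ℕ), Measurable i → (∃ N, ∀ x, i x ≤ N) →
      (fun x => c (i x)) ∈ bddMeasurable α := by
    rintro c i hi ⟨N, hN⟩
    refine ⟨(measurable_of_countable c).comp hi, ∑ j ∈ Finset.range (N + 1), |c j|, fun x => ?_⟩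
    exact Finset.single_le_sum (f := fun j => |c j|) (fun j _ => abs_nonneg _)
      (Finset.mem_range.2 (Nat.lt_succ_of_le (hN x)))
  have hsel : ∀ n : ℕ, ∃ i : α → ℕ, Measurable i ∧ (∀ x, i x ≤ n) ∧
      ∀ x, ∀ j ≤ n, a j * g x + b j ≤ a (i x) * g x + b (i x) := by
    intro n
    induction n with
    | zero =>
      refine ⟨fun _ => 0, measurable_const, fun _ => le_rfl, fun x j hj => ?_⟩
      rw [Nat.le_zero.1 hj]
    | succ n ih =>
      classical
      obtain ⟨i, hi, hin, hij⟩ := ih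
      have hS : MeasurableSet
          {x | a (i x) * g x + b (i x) ≤ a (n + 1) * g x + b (n + 1)} :=
        measurableSet_le ((((measurable_of_countable a).comp hi).mul hg).add
          ((measurable_of_countable b).comp hi)) ((hg.const_mul _).add_const _)
      refine ⟨fun x => if a (i x) * g x + b (i x) ≤ a (n + 1) * g x + b (n + 1)
        then n + 1 else i x, Measurable.ite hS measurable_const hi, fun x => ?_, fun x j hj => ?_⟩
      · dsimp only
        split_ifs
        · exact le_rfl
        · exact (hin x).trans n.le_succ
      · dsimp only
        split_ifs with h
        · rcases Nat.le_succ_iff.1 hj with hj | rfl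
          · exact (hij x j hj).trans h
          · exact le_rfl
        · rcases Nat.le_succ_iff.1 hj with hj | rfl
          · exact hij x j hj
          · exact (not_le.1 h).le
  choose i hi hin hij using hsel
  have hai := fun n => hbdd a (i n) (hi n) ⟨n, hin n⟩
  have hbi := fun n => hbdd b (i n) (hi n) ⟨n, hin n⟩
  have hnn : ∀ n x, 0 ≤ a (i n x) * g x + b (i n x) := fun n x => by
    simpa [ha, hb] using hij n x 0 (Nat.zero_le n)
  calc ∫⁻ x, ENNReal.ofReal (Φ (g x)) ∂ν
      ≤ ∫⁻ x, liminf (fun n => ENNReal.ofReal (a (i n x) * g x + b (i n x))) atTop ∂ν := by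
        refine lintegral_mono fun x => ?_
        refine le_of_forall_lt fun c hc => ?_
        obtain ⟨c', hcc', hc'⟩ := exists_between hc
        have hlt : c'.toReal < Φ (g x) := by
          rw [← ENNReal.lt_ofReal_iff_toReal_lt hc'.ne_top]
          exact hc'
        obtain ⟨j, hj⟩ := hΦ _ _ hlt
        refine hcc'.trans_le (le_liminf_of_le (by isBoundedDefault) ?_)
        filter_upwards [eventually_ge_atTop j] with n hn
        rw [← ENNReal.ofReal_toReal hc'.ne_top]
        exact ENNReal.ofReal_le_ofReal (hj.le.trans (hij n x j hn))
    _ ≤ liminf (fun n => ∫⁻ x, ENNReal.ofReal (a (i n x) * g x + b (i n x)) ∂ν) atTop :=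
        lintegral_liminf_le fun n => (((hai n).1.mul hg).add (hbi n).1).ennreal_ofReal
    _ ≤ 1 := by
        refine liminf_le_of_le (by isBoundedDefault) fun c hc => ?_
        obtain ⟨n, hn⟩ := hc.exists
        refine hn.trans ?_
        have hint : Integrable (fun x => a (i n x) * g x + b (i n x)) ν :=
          (integrable_mul_of_mem_bddMeasurable (hai n) hgi).add
            (integrable_of_mem_bddMeasurable (hbi n))
        rw [← ofReal_integral_eq_lintegral_ofReal hint (Eventually.of_forall (hnn n)),
          ENNReal.ofReal_le_one]
        exact H (i n) (hai n) (hbi n)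

end Density

/-! ### The dual of an Orlicz space and reflexivity -/

section Dual

variable {α : Type*} [MeasurableSpace α] {B : NFunction} {ν : Measure α}

lemma OrliczSpace.integrable [IsFiniteMeasure ν] (f : OrliczSpace B ν) :
    Integrable (f : α →ₘ[ν] ℝ) ν := f.2.integrable

lemma OrliczSpace.modular_le_one (f : OrliczSpace B ν) {k : ℝ} (hk : ‖f‖ < k) :
    modular B ν k⁻¹ (f : α →ₘ[ν] ℝ) ≤ 1 := f.2.modular_le_one hk

/-- A homogeneous bound may be checked on all scales `k` for which the modular of `f / k` is at
most one. -/
lemma MemOrlicz.le_mul_luxemburgNorm {f : α → ℝ} (hf : MemOrlicz B ν f) {a c : ℝ}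
    (h : ∀ k : ℝ, 0 < k → modular B ν k⁻¹ f ≤ 1 → a ≤ k * c) : a ≤ c * luxemburgNorm B ν f := by
  have ht : Tendsto (fun k : ℝ => k * c) (𝓝[>] luxemburgNorm B ν f)
      (𝓝 (luxemburgNorm B ν f * c)) :=
    (tendsto_id.mul_const c).mono_left nhdsWithin_le_nhds
  rw [mul_comm]
  refine ge_of_tendsto ht ?_
  filter_upwards [self_mem_nhdsWithin] with k hk
  exact h k ((luxemburgNorm_nonneg f).trans_lt hk) (hf.modular_le_one hk)

lemma le_mul_norm_of_forall_modular {f : OrliczSpace B ν} {a c : ℝ}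
    (h : ∀ k : ℝ, 0 < k → modular B ν k⁻¹ (f : α →ₘ[ν] ℝ) ≤ 1 → a ≤ k * c) : a ≤ c * ‖f‖ :=
  f.2.le_mul_luxemburgNorm h

lemma memOrlicz_of_modular_le_one {f : α → ℝ} (hf : AEStronglyMeasurable f ν) {k : ℝ} (hk : 0 < k)
    (h : modular B ν k⁻¹ f ≤ 1) : MemOrlicz B ν f := by
  refine ⟨hf, ?_⟩
  have ht : Tendsto (fun δ : ℝ => ENNReal.ofReal (δ * k)) (𝓝[>] 0) (𝓝 0) := by
    have := ENNReal.tendsto_ofReal ((tendsto_mul_nhdsGT hk).mono_right nhdsWithin_le_nhds)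
    rwa [ENNReal.ofReal_zero] at this
  refine tendsto_of_tendsto_of_tendsto_of_le_of_le' tendsto_const_nhds ht
    (Eventually.of_forall fun _ => zero_le) ?_
  filter_upwards [Ioo_mem_nhdsGT (inv_pos.2 hk)] with δ hδ
  have h1 : δ * k ≤ 1 := by
    have := mul_le_mul_of_nonneg_right hδ.2.le hk.le
    rwa [inv_mul_cancel₀ hk.ne'] at this
  have h2 := modular_mul_le (B := B) (μ := ν) (mul_nonneg hδ.1.le hk.le) h1 (inv_pos.2 hk).le f
  rw [mul_inv_cancel_right₀ hk.ne'] at h2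
  exact h2.trans (mul_le_of_le_one_right zero_le h)

variable [IsFiniteMeasure ν]

lemma memOrlicz_of_mem_bddMeasurable {h : α → ℝ} (hh : h ∈ bddMeasurable α) : MemOrlicz B ν h :=
  memOrlicz_of_abs_le hh.1.aestronglyMeasurable (Eventually.of_forall hh.2.choose_spec)

variable (B ν) in
/-- The inclusion of the bounded measurable functions in the Orlicz space. -/
def incl : bddMeasurable α →ₗ[ℝ] OrliczSpace B ν where
  toFun h := (memOrlicz_of_mem_bddMeasurable (B := B) h.2).toOrlicz
  map_add' _ _ := Subtype.ext (AEEqFun.mk_add_mk _ _ _ _).symm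
  map_smul' _ _ := Subtype.ext (AEEqFun.smul_mk _ _ _).symm

lemma coeFn_incl (h : bddMeasurable α) : (incl B ν h : α →ₘ[ν] ℝ) =ᵐ[ν] h.1 :=
  (memOrlicz_of_mem_bddMeasurable (B := B) h.2).coeFn_toOrlicz

lemma exists_abs_integral_mul_le (B : NFunction) {M η : ℝ} (hM : 0 ≤ M) (hη : 0 < η) :
    ∃ C : ℝ, 0 ≤ C ∧ ∀ (h : bddMeasurable α) (f : OrliczSpace B ν), (∀ x, |h.1 x| ≤ M) →
      |∫ x, h.1 x * (f : α →ₘ[ν] ℝ) x ∂ν| ≤ (η + C * ∫ x, |h.1 x| ∂ν) * ‖f‖ := by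
  obtain ⟨C, hC0, hC⟩ := exists_integral_abs_mul_le (ν := ν) B hM hη
  refine ⟨C, hC0, fun h f hM => le_mul_norm_of_forall_modular fun k hk hk1 => ?_⟩
  refine abs_integral_le_integral_abs.trans ?_
  simp only [mul_comm (h.1 _)]
  exact hC _ _ k hk f.2.1 hk1 (integrable_of_mem_bddMeasurable h.2) (Eventually.of_forall hM)

lemma exists_abs_integral_mul_le_norm (B : NFunction) (h : bddMeasurable α) :
    ∃ C : ℝ, 0 ≤ C ∧ ∀ f : OrliczSpace B ν,
      |∫ x, h.1 x * (f : α →ₘ[ν] ℝ) x ∂ν| ≤ C * ‖f‖ := by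
  obtain ⟨M, hM⟩ := h.2.2
  obtain ⟨C, hC0, hC⟩ := exists_abs_integral_mul_le (ν := ν) B (le_max_right M 0) one_pos
  exact ⟨_, add_nonneg zero_le_one (mul_nonneg hC0 (integral_nonneg fun x => abs_nonneg _)),
    fun f => hC h f fun x => (hM x).trans (le_max_left _ _)⟩

lemma integrable_bdd_mul (h : bddMeasurable α) (f : OrliczSpace B ν) :
    Integrable (fun x => h.1 x * (f : α →ₘ[ν] ℝ) x) ν :=
  integrable_mul_of_mem_bddMeasurable h.2 f.integrable

variable (B ν) in
/-- The functional `f ↦ ∫ h f` on the Orlicz space given by a bounded measurable `h`. -/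
def pairing : bddMeasurable α →ₗ[ℝ] StrongDual ℝ (OrliczSpace B ν) where
  toFun h := LinearMap.mkContinuousOfExistsBound
    { toFun := fun f => ∫ x, h.1 x * (f : α →ₘ[ν] ℝ) x ∂ν
      map_add' := fun f g => by
        rw [← integral_add (integrable_bdd_mul h f) (integrable_bdd_mul h g)]
        refine integral_congr_ae ?_
        filter_upwards [AEEqFun.coeFn_add (f : α →ₘ[ν] ℝ) (g : α →ₘ[ν] ℝ)] with x hx
        rw [← mul_add]
        exact congrArg _ hx
      map_smul' := fun c f => by
        rw [RingHom.id_apply, smul_eq_mul, ← integral_const_mul]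
        refine integral_congr_ae ?_
        filter_upwards [AEEqFun.coeFn_smul c (f : α →ₘ[ν] ℝ)] with x hx
        rw [mul_left_comm]
        exact congrArg _ hx }
    ((exists_abs_integral_mul_le_norm B h).imp fun _ hC => hC.2)
  map_add' h h' := by
    ext f
    change ∫ x, (h.1 x + h'.1 x) * _ ∂ν = _ + _
    simp only [add_mul]
    exact integral_add (integrable_bdd_mul h f) (integrable_bdd_mul h' f)
  map_smul' c h := by
    ext f
    change ∫ x, (c * h.1 x) * _ ∂ν = c * _
    simp only [mul_assoc]
    exact integral_const_mul _ _

lemma pairing_apply (h : bddMeasurable α) (f : OrliczSpace B ν) :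
    pairing B ν h f = ∫ x, h.1 x * (f : α →ₘ[ν] ℝ) x ∂ν := rfl

/-- It suffices to bound the pairing from above where the modular is at most one. -/
lemma norm_pairing_le {h : bddMeasurable α} {c : ℝ} (hc : 0 ≤ c)
    (H : ∀ (f : OrliczSpace B ν) (k : ℝ), 0 < k → modular B ν k⁻¹ (f : α →ₘ[ν] ℝ) ≤ 1 →
      pairing B ν h f ≤ k * c) : ‖pairing B ν h‖ ≤ c := by
  refine ContinuousLinearMap.opNorm_le_bound _ hc fun f => ?_
  rw [Real.norm_eq_abs, abs_le']
  refine ⟨le_mul_norm_of_forall_modular (H f), ?_⟩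
  rw [← map_neg, ← norm_neg f]
  exact le_mul_norm_of_forall_modular (H (-f))

lemma modular_incl_sub (f : OrliczSpace B ν) (h : bddMeasurable α) (δ : ℝ) :
    modular B ν δ (fun x => (incl B ν h : α →ₘ[ν] ℝ) x - (f : α →ₘ[ν] ℝ) x)
      = modular B ν δ (fun x => h.1 x - (f : α →ₘ[ν] ℝ) x) :=
  modular_congr ((coeFn_incl h).mono fun x hx => by
    rw [hx]) δ

/-- Under `Δ₂`, truncations converge in norm. -/
lemma tendsto_incl_trunc (hB : DeltaTwo B) (f : OrliczSpace B ν) :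
    Tendsto (fun N : ℕ => incl B ν ⟨trunc (f : α →ₘ[ν] ℝ) N,
      trunc_mem_bddMeasurable (AEEqFun.measurable _) N⟩) atTop (𝓝 f) := by
  refine tendsto_of_modular_le fun k hk => ?_
  have hk' : 0 ≤ k⁻¹ := (inv_pos.2 hk).le
  have hm : Measurable (f : α →ₘ[ν] ℝ) := AEEqFun.measurable _
  have ht : Tendsto (fun N : ℕ => modular B ν k⁻¹
      (fun x => trunc (f : α →ₘ[ν] ℝ) N x - (f : α →ₘ[ν] ℝ) x)) atTop (𝓝 (∫⁻ _, 0 ∂ν)) := by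
    refine tendsto_lintegral_of_dominated_convergence
      (fun x => ENNReal.ofReal (B (k⁻¹ * |(f : α →ₘ[ν] ℝ) x|)))
      (fun N => ?_) (fun N => Eventually.of_forall fun x => ?_) (f.2.modular_ne_top hB hk')
      (Eventually.of_forall fun x => ?_)
    · exact ((B.continuous_abs hk').measurable.comp
        ((trunc_mem_bddMeasurable hm N).1.sub hm)).ennreal_ofReal
    · refine ENNReal.ofReal_le_ofReal (B.mono (by positivity)
        (mul_le_mul_of_nonneg_left ?_ hk'))
      dsimp only [trunc]
      split_ifs <;> simp
    · refine tendsto_const_nhds.congr' ?_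
      filter_upwards [trunc_eventually_eq (f : α →ₘ[ν] ℝ) x] with N hN
      simp [hN, B.map_zero]
  rw [lintegral_zero] at ht
  filter_upwards [ht.eventually_le_const one_pos] with N hN
  rwa [modular_incl_sub]

lemma norm_incl_le_one_add (h : bddMeasurable α) :
    ‖incl B ν h‖ ≤ 1 + ∫ x, B |h.1 x| ∂ν := by
  obtain ⟨hm, C, hC⟩ := h.2
  have h0 : 0 ≤ ∫ x, B |h.1 x| ∂ν := integral_nonneg fun x => B.nonneg (abs_nonneg _)
  have hBm : Measurable fun x => B |h.1 x| := by
    simpa [Function.comp_def] using (B.continuous_abs zero_le_one).measurable.comp hm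
  have hBi : Integrable (fun x => B |h.1 x|) ν :=
    (integrable_const (B C)).mono' hBm.aestronglyMeasurable (Eventually.of_forall fun x => by
      rw [Real.norm_eq_abs, abs_of_nonneg (B.nonneg (abs_nonneg _))]
      exact B.mono (abs_nonneg _) (hC x))
  rw [norm_def, luxemburgNorm_congr (coeFn_incl h)]
  refine luxemburgNorm_le (by positivity) ?_
  have h1 := modular_mul_le (B := B) (μ := ν) (c := (1 + ∫ x, B |h.1 x| ∂ν)⁻¹) (δ := 1)
    (by positivity) (inv_le_one_of_one_le₀ (by linarith)) zero_le_one h.1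
  rw [mul_one] at h1
  refine h1.trans ?_
  simp only [modular, one_mul]
  rw [← ofReal_integral_eq_lintegral_ofReal hBi
    (Eventually.of_forall fun x => B.nonneg (abs_nonneg _)), ← ENNReal.ofReal_mul (by positivity),
    ENNReal.ofReal_le_one, inv_mul_le_iff₀ (by positivity)]
  linarith

lemma isL1Continuous_comp_incl (ℓ : StrongDual ℝ (OrliczSpace B ν)) :
    IsL1Continuous ν (ℓ.toLinearMap ∘ₗ incl B ν) := by
  intro M η hM hη
  -- the scale `k` is chosen so that `‖ℓ‖ k ≤ η`
  have hk : 0 < η / (‖ℓ‖ + 1) := by positivity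
  generalize hkdef : η / (‖ℓ‖ + 1) = k at hk
  have hBM : 0 < B (k⁻¹ * M) := B.pos _ (by positivity)
  refine ⟨(B (k⁻¹ * M) / M)⁻¹, by positivity, fun h hh hδ => ?_⟩
  have h1 : modular B ν k⁻¹ h.1 ≤ 1 := by
    refine (modular_le_of_abs_le hM (inv_pos.2 hk).le (integrable_of_mem_bddMeasurable h.2)
      (Eventually.of_forall hh)).trans ?_
    rw [ENNReal.ofReal_le_one]
    have := mul_le_mul_of_nonneg_left hδ (by positivity : 0 ≤ B (k⁻¹ * M) / M)
    rwa [mul_inv_cancel₀ (by positivity)] at this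
  have h2 : ‖incl B ν h‖ ≤ k := by
    rw [norm_def, luxemburgNorm_congr (coeFn_incl h)]
    exact luxemburgNorm_le hk h1
  have h3 : ‖ℓ (incl B ν h)‖ ≤ ‖ℓ‖ * k := ℓ.le_opNorm_of_le h2
  refine h3.trans ?_
  rw [← hkdef, mul_div_assoc', div_le_iff₀ (by positivity)]
  nlinarith [norm_nonneg ℓ]

lemma isL1Continuous_comp_pairing (J : StrongDual ℝ (StrongDual ℝ (OrliczSpace B ν))) :
    IsL1Continuous ν (J.toLinearMap ∘ₗ pairing B ν) := by
  intro M η hM hη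
  have hη' : 0 < η / (‖J‖ + 1) / 2 := by positivity
  obtain ⟨C, hC0, hC⟩ := exists_abs_integral_mul_le (ν := ν) B hM.le hη'
  refine ⟨η / (‖J‖ + 1) / 2 / (C + 1), by positivity, fun h hh hδ => ?_⟩
  have h1 : ‖pairing B ν h‖ ≤ η / (‖J‖ + 1) := by
    refine ContinuousLinearMap.opNorm_le_bound _ (by positivity) fun f => ?_
    refine (hC h f hh).trans (mul_le_mul_of_nonneg_right ?_ (norm_nonneg f))
    have h2 : C * ∫ x, |h.1 x| ∂ν ≤ η / (‖J‖ + 1) / 2 := by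
      refine (mul_le_mul_of_nonneg_left hδ hC0).trans ?_
      rw [mul_div_assoc', div_le_iff₀ (by positivity)]
      nlinarith
    linarith
  have h3 : ‖J (pairing B ν h)‖ ≤ ‖J‖ * (η / (‖J‖ + 1)) := J.le_opNorm_of_le h1
  refine h3.trans ?_
  rw [mul_div_assoc', div_le_iff₀ (by positivity)]
  nlinarith [norm_nonneg J]

lemma measurable_conjugate (B : NFunction) : Measurable (conjugate B) :=
  Monotone.measurable fun _ _ => B.conjugate_mono

/-- Riesz representation: under `Δ₂`, a continuous functional on `L^B` is the integral against a
function in the class of the complementary function. -/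
theorem exists_representation (hB : DeltaTwo B) (ℓ : StrongDual ℝ (OrliczSpace B ν)) :
    ∃ (g : α → ℝ) (L : ℝ), Measurable g ∧ 0 < L ∧
      Integrable (fun x => conjugate B (L⁻¹ * |g x|)) ν ∧
      ∀ f : OrliczSpace B ν, ℓ f = ∫ x, (f : α →ₘ[ν] ℝ) x * g x ∂ν := by
  obtain ⟨g, hgm, hgi, hg⟩ := (isL1Continuous_comp_incl ℓ).exists_density
  have hL : 0 < ‖ℓ‖ + 1 := by positivity
  have hgL : Measurable fun x => (‖ℓ‖ + 1)⁻¹ * g x := hgm.const_mul _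
  let s : ℕ → ℝ := fun n => n.casesOn 0 (TopologicalSpace.denseSeq ℝ)
  have hconj : ∫⁻ x, ENNReal.ofReal (conjugate B |(‖ℓ‖ + 1)⁻¹ * g x|) ∂ν ≤ 1 := by
    refine lintegral_le_one_of_affine (Φ := fun t => conjugate B |t|) (a := s)
      (b := fun n => -B |s n|) rfl (by simp [s, B.map_zero]) (fun t c hc => ?_) hgL
      (hgi.const_mul _) fun i hi hbi => ?_
    · obtain ⟨_, ⟨r, hr, rfl⟩, hrc⟩ := exists_lt_of_lt_csSup
        (image_nonempty.2 ⟨0, self_mem_Ici⟩) hc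
      have hr : 0 ≤ r := hr
      have hcont : Continuous fun u : ℝ => u * t + -B |u| := by
        have := B.continuous_abs zero_le_one
        simp only [one_mul] at this
        fun_prop
      have hne : ∃ u : ℝ, c < u * t + -B |u| := by
        rcases le_total 0 t with ht | ht
        · refine ⟨r, ?_⟩
          rw [abs_of_nonneg ht] at hrc
          rwa [abs_of_nonneg hr, ← sub_eq_add_neg]
        · refine ⟨-r, ?_⟩
          rw [abs_of_nonpos ht] at hrc
          rwa [abs_neg, abs_of_nonneg hr, ← sub_eq_add_neg, neg_mul, ← mul_neg]
      obtain ⟨n, hn⟩ := (TopologicalSpace.denseRange_denseSeq ℝ).exists_mem_open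
        (isOpen_lt continuous_const hcont) hne
      exact ⟨n + 1, hn⟩
    · -- the test is the dual inequality for the bounded function `s ∘ i`
      have h1 := hg ⟨_, hi⟩
      have h2 := norm_incl_le_one_add (B := B) (ν := ν) ⟨_, hi⟩
      have h3 := (le_abs_self _).trans (ℓ.le_opNorm (incl B ν ⟨_, hi⟩))
      rw [integral_add (integrable_mul_of_mem_bddMeasurable hi (hgi.const_mul _))
        (integrable_of_mem_bddMeasurable hbi), integral_neg]
      simp only [mul_left_comm _ (‖ℓ‖ + 1)⁻¹]
      rw [integral_const_mul]
      have h4 : (‖ℓ‖ + 1)⁻¹ * ∫ x, s (i x) * g x ∂ν ≤ ‖incl B ν ⟨_, hi⟩‖ := by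
        rw [inv_mul_le_iff₀ hL, ← h1]
        refine h3.trans ?_
        nlinarith [norm_nonneg (incl B ν ⟨_, hi⟩)]
      linarith
  have habs : ∀ x, |(‖ℓ‖ + 1)⁻¹ * g x| = (‖ℓ‖ + 1)⁻¹ * |g x| := fun x => by
    rw [abs_mul, abs_of_pos (inv_pos.2 hL)]
  simp only [habs] at hconj
  have hcm : Measurable fun x => conjugate B ((‖ℓ‖ + 1)⁻¹ * |g x|) :=
    (measurable_conjugate B).comp (hgm.abs.const_mul _)
  have hci : Integrable (fun x => conjugate B ((‖ℓ‖ + 1)⁻¹ * |g x|)) ν :=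
    (lintegral_ofReal_ne_top_iff_integrable hcm.aestronglyMeasurable
      (Eventually.of_forall fun x => B.conjugate_nonneg _)).1
      (ne_top_of_le_ne_top ENNReal.one_ne_top hconj)
  refine ⟨g, ‖ℓ‖ + 1, hgm, hL, hci, fun f => ?_⟩
  have hfm : Measurable (f : α →ₘ[ν] ℝ) := AEEqFun.measurable _
  obtain ⟨k, hk, hk1⟩ := f.2.exists_le_one
  have hfi := integrable_modular f.2.1 (inv_pos.2 hk).le
    (ne_top_of_le_ne_top ENNReal.one_ne_top hk1)
  refine tendsto_nhds_unique ((ℓ.continuous.tendsto f).comp (tendsto_incl_trunc hB f)) ?_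
  have he : ∀ N : ℕ, ℓ (incl B ν ⟨trunc (f : α →ₘ[ν] ℝ) N, trunc_mem_bddMeasurable hfm N⟩)
      = ∫ x, trunc (f : α →ₘ[ν] ℝ) N x * g x ∂ν := fun N => hg _
  simp only [Function.comp_def, he]
  refine tendsto_integral_of_dominated_convergence
    (fun x => k * (‖ℓ‖ + 1) * (B (k⁻¹ * |(f : α →ₘ[ν] ℝ) x|)
      + conjugate B ((‖ℓ‖ + 1)⁻¹ * |g x|)))
    (fun N => ((trunc_mem_bddMeasurable hfm N).1.mul hgm).aestronglyMeasurable)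
    ((hfi.add hci).const_mul _) (fun N => Eventually.of_forall fun x => ?_)
    (Eventually.of_forall fun x => ?_)
  · have h1 := B.mul_le_add_conjugate (s := k⁻¹ * |(f : α →ₘ[ν] ℝ) x|) (by positivity)
      ((‖ℓ‖ + 1)⁻¹ * |g x|)
    have h2 := mul_le_mul_of_nonneg_left h1 (by positivity : 0 ≤ k * (‖ℓ‖ + 1))
    have e : k * (‖ℓ‖ + 1) * (k⁻¹ * |(f : α →ₘ[ν] ℝ) x| * ((‖ℓ‖ + 1)⁻¹ * |g x|))
        = |(f : α →ₘ[ν] ℝ) x| * |g x| := by field_simp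
    rw [norm_mul]
    rw [e] at h2
    exact (mul_le_mul_of_nonneg_right (abs_trunc_le _ N x) (abs_nonneg _)).trans h2
  · refine tendsto_const_nhds.congr' ?_
    filter_upwards [trunc_eventually_eq (f : α →ₘ[ν] ℝ) x] with N hN
    rw [hN]

/-- Under `Δ₂` and `∇₂`, integration against bounded functions is dense in the dual. -/
theorem exists_norm_sub_pairing_le (hB : DeltaTwo B) (hB' : NablaTwo B)
    (ℓ : StrongDual ℝ (OrliczSpace B ν)) {η : ℝ} (hη : 0 < η) :
    ∃ h : bddMeasurable α, ‖ℓ - pairing B ν h‖ ≤ η := by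
  obtain ⟨g, L, hgm, hL, hgi, hg⟩ := exists_representation hB ℓ
  have hK : 0 < 2 / η := by positivity
  generalize hKdef : 2 / η = K at hK
  obtain ⟨a, b, ha, hb, hab⟩ := DeltaTwo.exists_le hB' (fun t _ => B.conjugate_nonneg t)
    (fun s t _ hst => B.conjugate_mono hst) (K := K * L) (by positivity)
  have hKm : Measurable fun x => conjugate B (K * |g x|) :=
    (measurable_conjugate B).comp (hgm.abs.const_mul _)
  have hKi : Integrable (fun x => conjugate B (K * |g x|)) ν := by
    refine ((hgi.const_mul a).add (integrable_const b)).mono' hKm.aestronglyMeasurable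
      (Eventually.of_forall fun x => ?_)
    rw [Real.norm_eq_abs, abs_of_nonneg (B.conjugate_nonneg _)]
    have := hab (L⁻¹ * |g x|) (by positivity)
    rwa [mul_assoc, mul_inv_cancel_left₀ hL.ne'] at this
  have hzero : ∀ (N : ℕ) x, (N : ℝ) < |g x| ∨ g x = trunc g N x := fun N x => by
    rcases le_or_gt |g x| N with h | h
    · exact Or.inr (if_pos h).symm
    · exact Or.inl h
  have hS : ∀ N : ℕ, MeasurableSet {x | (N : ℝ) < |g x|} := fun N =>
    measurableSet_lt measurable_const hgm.abs
  have htail : Tendsto (fun N : ℕ => ∫ x, {x | (N : ℝ) < |g x|}.indicator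
      (fun x => conjugate B (K * |g x|)) x ∂ν) atTop (𝓝 (∫ _, 0 ∂ν)) := by
    refine tendsto_integral_of_dominated_convergence (fun x => conjugate B (K * |g x|))
      (fun N => (hKm.indicator (hS N)).aestronglyMeasurable) hKi
      (fun N => Eventually.of_forall fun x => ?_) (Eventually.of_forall fun x => ?_)
    · refine (norm_indicator_le_norm_self _ x).trans_eq ?_
      rw [Real.norm_eq_abs, abs_of_nonneg (B.conjugate_nonneg _)]
    · refine tendsto_const_nhds.congr' ?_
      obtain ⟨N, hN⟩ := exists_nat_ge |g x|
      filter_upwards [eventually_ge_atTop N] with n hn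
      rw [indicator_of_notMem]
      exact not_lt.2 (hN.trans (by exact_mod_cast hn))
  rw [integral_zero] at htail
  obtain ⟨N, hN⟩ := (htail.eventually_le_const one_pos).exists
  refine ⟨⟨trunc g N, trunc_mem_bddMeasurable hgm N⟩,
    ContinuousLinearMap.opNorm_le_bound _ hη.le fun f =>
      le_mul_norm_of_forall_modular fun k hk hk1 => ?_⟩
  have hfi := integrable_modular f.2.1 (inv_pos.2 hk).le
    (ne_top_of_le_ne_top ENNReal.one_ne_top hk1)
  have hf1 := integral_modular_le f.2.1 (inv_pos.2 hk).le hk1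
  have hti : Integrable ({x | (N : ℝ) < |g x|}.indicator (fun x => conjugate B (K * |g x|))) ν :=
    hKi.indicator (hS N)
  have hpt : ∀ x, |(f : α →ₘ[ν] ℝ) x * g x - trunc g N x * (f : α →ₘ[ν] ℝ) x|
      ≤ k / K * (B (k⁻¹ * |(f : α →ₘ[ν] ℝ) x|)
        + {x | (N : ℝ) < |g x|}.indicator (fun x => conjugate B (K * |g x|)) x) := by
    intro x
    have hb0 : 0 ≤ B (k⁻¹ * |(f : α →ₘ[ν] ℝ) x|) := B.nonneg (by positivity)
    rcases hzero N x with h | h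
    · have ht : trunc g N x = 0 := if_neg (not_le.2 h)
      rw [ht, zero_mul, sub_zero, indicator_of_mem (by exact h), abs_mul]
      have h1 := B.mul_le_add_conjugate (s := k⁻¹ * |(f : α →ₘ[ν] ℝ) x|) (by positivity)
        (K * |g x|)
      have h2 := mul_le_mul_of_nonneg_left h1 (by positivity : 0 ≤ k / K)
      have e : k / K * (k⁻¹ * |(f : α →ₘ[ν] ℝ) x| * (K * |g x|))
        = |(f : α →ₘ[ν] ℝ) x| * |g x| := by field_simp
      rwa [e] at h2
    · rw [← h, mul_comm, sub_self, abs_zero]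
      exact mul_nonneg (by positivity) (add_nonneg hb0
        (indicator_nonneg (fun x _ => B.conjugate_nonneg _) x))
  -- the representing integrand is integrable because its difference with the truncated one is
  have hdi : Integrable (fun x => (f : α →ₘ[ν] ℝ) x * g x
      - trunc g N x * (f : α →ₘ[ν] ℝ) x) ν :=
    ((hfi.add hti).const_mul _).mono' (((f : α →ₘ[ν] ℝ).measurable.mul hgm).sub
      ((trunc_mem_bddMeasurable hgm N).1.mul (f : α →ₘ[ν] ℝ).measurable)).aestronglyMeasurable
      (Eventually.of_forall hpt)
  have hpi := integrable_bdd_mul ⟨trunc g N, trunc_mem_bddMeasurable hgm N⟩ f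
  have hfgi : Integrable (fun x => (f : α →ₘ[ν] ℝ) x * g x) ν := by
    exact (hdi.add hpi).congr (Eventually.of_forall fun x => sub_add_cancel _ _)
  rw [sub_apply, hg, pairing_apply, ← integral_sub hfgi hpi, Real.norm_eq_abs]
  refine abs_integral_le_integral_abs.trans ((integral_mono hdi.abs
    ((hfi.add hti).const_mul _) hpt).trans ?_)
  rw [integral_const_mul, integral_add' hfi hti]
  have h3 : k / K = k * η / 2 := by
    rw [← hKdef]
    field_simp
  rw [h3]
  have h4 := mul_le_mul_of_nonneg_left (add_le_add hf1 hN) (by positivity : 0 ≤ k * η / 2)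
  linarith

/-- Two continuous functionals of the dual which agree on bounded functions are equal. -/
lemma bidual_ext (hB : DeltaTwo B) (hB' : NablaTwo B)
    {J J' : StrongDual ℝ (StrongDual ℝ (OrliczSpace B ν))}
    (h : ∀ u, J (pairing B ν u) = J' (pairing B ν u)) : J = J' := by
  have hd : DenseRange (pairing B ν) := by
    refine Metric.dense_iff.2 fun ℓ r hr => ?_
    obtain ⟨u, hu⟩ := exists_norm_sub_pairing_le hB hB' ℓ (half_pos hr)
    refine ⟨_, ?_, mem_range_self u⟩
    rw [Metric.mem_ball, dist_comm, dist_eq_norm]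
    linarith
  exact ContinuousLinearMap.coe_inj.1 (LinearMap.ext fun ℓ => congrFun
    (hd.equalizer J.continuous J'.continuous (funext h)) ℓ)

/-- Reflexivity of `L^B` under `Δ₂` and `∇₂`. -/
theorem exists_eq_eval (hB : DeltaTwo B) (hB' : NablaTwo B)
    (J : StrongDual ℝ (StrongDual ℝ (OrliczSpace B ν))) :
    ∃ f : OrliczSpace B ν, ∀ ℓ, J ℓ = ℓ f := by
  obtain ⟨g, hgm, hgi, hg⟩ := (isL1Continuous_comp_pairing J).exists_density
  have hR : 0 < ‖J‖ + 1 := by positivity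
  have hmod : modular B ν (‖J‖ + 1)⁻¹ g ≤ 1 := by
    have hcont : Continuous fun t : ℝ => B |t| := by
      simpa using B.continuous_abs zero_le_one
    obtain ⟨l, c, hle, hsup⟩ := B.convexOn_abs.real_univ_sSup_of_nat_affine_eq
      hcont.lowerSemicontinuous
    let a : ℕ → ℝ := fun n => n.casesOn 0 fun n => l n 1
    let b : ℕ → ℝ := fun n => n.casesOn 0 c
    have hl : ∀ n t, l n t = l n 1 * t := fun n t => by
      rw [mul_comm, ← smul_eq_mul, ← map_smul, smul_eq_mul, mul_one]
    have hab : ∀ n t, a n * t + b n ≤ B |t| := by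
      rintro (_ | n) t
      · simpa [a, b] using B.nonneg (abs_nonneg t)
      · have := hle n t
        simp only [Pi.add_apply, Function.const_apply] at this
        rwa [hl] at this
    have habs : ∀ x, (‖J‖ + 1)⁻¹ * |g x| = |(‖J‖ + 1)⁻¹ * g x| := fun x => by
      rw [abs_mul, abs_of_pos (inv_pos.2 hR)]
    simp only [modular, habs]
    refine lintegral_le_one_of_affine (Φ := fun t => B |t|) (a := a) (b := b) rfl rfl
      (fun t c' hc' => ?_) (hgm.const_mul _) (hgi.const_mul _) fun i hi hbi => ?_
    · have h1 := congrFun hsup t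
      rw [iSup_apply] at h1
      obtain ⟨n, hn⟩ := exists_lt_of_lt_ciSup (hc'.trans_eq h1.symm)
      refine ⟨n + 1, ?_⟩
      simp only [Pi.add_apply, Function.const_apply] at hn
      rwa [hl] at hn
    · have hbint := integrable_of_mem_bddMeasurable (ν := ν) hbi
      have hb0 : ∫ x, b (i x) ∂ν ≤ 0 := integral_nonpos fun x => by
        simpa [B.map_zero] using hab (i x) 0
      have hn : ‖pairing B ν ⟨_, hi⟩‖ ≤ 1 - ∫ x, b (i x) ∂ν := by
        refine norm_pairing_le (by linarith) fun f k hk hk1 => ?_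
        have hfi := integrable_modular f.2.1 (inv_pos.2 hk).le
          (ne_top_of_le_ne_top ENNReal.one_ne_top hk1)
        have hf1 := integral_modular_le f.2.1 (inv_pos.2 hk).le hk1
        have hpt : ∀ x, a (i x) * (f : α →ₘ[ν] ℝ) x
            ≤ k * (B (k⁻¹ * |(f : α →ₘ[ν] ℝ) x|) - b (i x)) := fun x => by
          have h1 := hab (i x) (k⁻¹ * (f : α →ₘ[ν] ℝ) x)
          rw [abs_mul, abs_of_pos (inv_pos.2 hk)] at h1
          have h2 := mul_le_mul_of_nonneg_left h1 hk.le
          have e : k * (a (i x) * (k⁻¹ * (f : α →ₘ[ν] ℝ) x) + b (i x))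
              = a (i x) * (f : α →ₘ[ν] ℝ) x + k * b (i x) := by field_simp
          rw [e] at h2
          linarith
        rw [pairing_apply]
        refine (integral_mono (integrable_bdd_mul ⟨_, hi⟩ f)
          ((hfi.sub hbint).const_mul k) hpt).trans ?_
        rw [integral_const_mul, integral_sub' hfi hbint]
        exact mul_le_mul_of_nonneg_left (by linarith) hk.le
      have h3 := (le_abs_self _).trans (J.le_opNorm (pairing B ν ⟨_, hi⟩))
      have h1 := hg ⟨_, hi⟩
      rw [integral_add (integrable_mul_of_mem_bddMeasurable hi (hgi.const_mul _)) hbint]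
      simp only [mul_left_comm _ (‖J‖ + 1)⁻¹]
      rw [integral_const_mul]
      have h4 : (‖J‖ + 1)⁻¹ * ∫ x, a (i x) * g x ∂ν ≤ ‖pairing B ν ⟨_, hi⟩‖ := by
        rw [inv_mul_le_iff₀ hR, ← h1]
        refine h3.trans ?_
        nlinarith [norm_nonneg (pairing B ν ⟨_, hi⟩)]
      linarith
  have hmem := memOrlicz_of_modular_le_one hgm.aestronglyMeasurable hR hmod
  refine ⟨hmem.toOrlicz, fun ℓ => ?_⟩
  have := bidual_ext hB hB' (J := J)
    (J' := NormedSpace.inclusionInDoubleDual ℝ _ hmem.toOrlicz) fun u => by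
      refine (hg u).trans (integral_congr_ae ?_)
      filter_upwards [hmem.coeFn_toOrlicz] with x hx
      rw [hx]
  rw [this]
  rfl

end Dual

/-! ### Weak topology -/

section WeakTopology

variable {E : Type*} [NormedAddCommGroup E] [NormedSpace ℝ E]

lemma tendsto_toWeakSpace_iff {ι : Type*} {l : Filter ι} {u : ι → E} {v : E} :
    Tendsto (fun n => toWeakSpace ℝ E (u n)) l (𝓝 (toWeakSpace ℝ E v)) ↔
      ∀ ℓ : StrongDual ℝ E, Tendsto (fun n => ℓ (u n)) l (𝓝 (ℓ v)) :=
  WeakBilin.tendsto_iff_forall_eval_tendsto _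
    (fun _ _ h => (SeparatingDual.eq_iff_forall_dual_eq (R := ℝ)).2 fun ℓ =>
      LinearMap.congr_fun h ℓ)

lemma continuous_dual_weakSpace (ℓ : StrongDual ℝ E) :
    Continuous fun x : WeakSpace ℝ E => ℓ ((toWeakSpace ℝ E).symm x) :=
  WeakBilin.eval_continuous _ ℓ

/-- Relatively weakly compact sequences are bounded (uniform boundedness in the dual). -/
lemma RelWeaklyCompact.exists_norm_le {u : ℕ → E} (h : RelWeaklyCompact u) :
    ∃ R : ℝ, ∀ n, ‖u n‖ ≤ R := by
  obtain ⟨R, hR⟩ := banach_steinhaus (g := fun n => NormedSpace.inclusionInDoubleDual ℝ E (u n))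
    fun ℓ => by
      obtain ⟨C, hC⟩ := (h.image (continuous_dual_weakSpace ℓ)).isBounded.exists_norm_le
      exact ⟨C, fun n => hC _ (mem_image_of_mem _ (subset_closure (mem_range_self n)))⟩
  refine ⟨R, fun n => ?_⟩
  rw [← (NormedSpace.inclusionInDoubleDualLi ℝ (E := E)).norm_map (u n)]
  exact hR n

/-- In a reflexive space, bounded sequences are relatively weakly compact: an ultrafilter on a
ball has a limit in the bidual, which is an element of the ball. -/
lemma relWeaklyCompact_of_norm_le
    (hE : ∀ J : StrongDual ℝ (StrongDual ℝ E), ∃ f : E, ∀ ℓ, J ℓ = ℓ f) {u : ℕ → E} {R : ℝ}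
    (hu : ∀ n, ‖u n‖ ≤ R) : RelWeaklyCompact u := by
  have hR : 0 ≤ R := (norm_nonneg _).trans (hu 0)
  have hball : IsCompact {x : WeakSpace ℝ E | ‖(toWeakSpace ℝ E).symm x‖ ≤ R} := by
    refine isCompact_iff_ultrafilter_le_nhds'.2 fun U hU => ?_
    have hlim : ∀ ℓ : StrongDual ℝ E, ∃ y : ℝ, ‖y‖ ≤ R * ‖ℓ‖ ∧
        Tendsto (fun x : WeakSpace ℝ E => ℓ ((toWeakSpace ℝ E).symm x)) U (𝓝 y) := by
      intro ℓ
      have hK : IsCompact (Metric.closedBall (0 : ℝ) (R * ‖ℓ‖)) := isCompact_closedBall _ _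
      obtain ⟨y, hy, hle⟩ := hK.ultrafilter_le_nhds
        (U.map fun x : WeakSpace ℝ E => ℓ ((toWeakSpace ℝ E).symm x)) (by
          rw [le_principal_iff, Ultrafilter.coe_map, mem_map]
          filter_upwards [hU] with x hx
          rw [mem_preimage, mem_closedBall_zero_iff, mul_comm]
          exact ℓ.le_opNorm_of_le hx)
      exact ⟨y, by simpa using hy, hle⟩
    choose y hyb hy using hlim
    let J : StrongDual ℝ (StrongDual ℝ E) := LinearMap.mkContinuous
      { toFun := y
        map_add' := fun ℓ ℓ' => tendsto_nhds_unique (hy (ℓ + ℓ')) ((hy ℓ).add (hy ℓ'))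
        map_smul' := fun c ℓ => tendsto_nhds_unique (hy (c • ℓ)) ((hy ℓ).const_smul c) } R hyb
    obtain ⟨f, hf⟩ := hE J
    have hf' : ∀ ℓ : StrongDual ℝ E, y ℓ = ℓ f := hf
    refine ⟨toWeakSpace ℝ E f, ?_, ?_⟩
    · exact NormedSpace.norm_le_dual_bound ℝ f hR fun ℓ => by rw [← hf']; exact hyb ℓ
    · exact (tendsto_toWeakSpace_iff (u := fun x => (toWeakSpace ℝ E).symm x)).2
        fun ℓ => by rw [← hf']; exact hy ℓ
  refine hball.closure_of_subset ?_
  rintro _ ⟨n, rfl⟩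
  exact hu n

/-- Weak lower semicontinuity of the norm. -/
lemma WeaklyTendsto.enorm_le_liminf {u : ℕ → E} {v : E} (h : WeaklyTendsto u v) :
    ‖v‖ₑ ≤ liminf (fun n => ‖u n‖ₑ) atTop := by
  obtain ⟨ℓ, hℓ, hv⟩ := exists_dual_vector'' ℝ v
  have h1 : Tendsto (fun n => ‖ℓ (u n)‖ₑ) atTop (𝓝 ‖ℓ v‖ₑ) :=
    ((tendsto_toWeakSpace_iff.1 h ℓ).enorm)
  have h2 : ‖ℓ v‖ₑ = ‖v‖ₑ := by
    rw [hv]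
    simp
  rw [← h2, ← h1.liminf_eq]
  refine liminf_le_liminf (Eventually.of_forall fun n => ?_)
  rw [enorm_le_iff_norm_le]
  exact (ℓ.le_of_opNorm_le hℓ _).trans_eq (one_mul _)

end WeakTopology

/-! ### Norm comparison and density of continuous functions -/

section Density

variable {α β : Type*} [MeasurableSpace α] [MeasurableSpace β] {B : NFunction} {ν : Measure α}
  {ρ : Measure β}

/-- A comparison of modulars gives a comparison of norms, by convexity. -/
lemma luxemburgNorm_le_of_modular_le {f : α → ℝ} {g : β → ℝ} {C : ENNReal} (hC : C ≠ ⊤)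
    (hf : MemOrlicz B ν f)
    (h : ∀ δ : ℝ, 0 ≤ δ → modular B ρ δ g ≤ C * modular B ν δ f) :
    luxemburgNorm B ρ g ≤ (1 + C.toReal) * luxemburgNorm B ν f := by
  have hC0 : 0 ≤ C.toReal := ENNReal.toReal_nonneg
  refine hf.le_mul_luxemburgNorm fun k hk hk1 => luxemburgNorm_le (by positivity) ?_
  refine (h _ (by positivity)).trans ?_
  have h1 := modular_mul_le (B := B) (μ := ν) (c := (1 + C.toReal)⁻¹) (δ := k⁻¹)
    (by positivity) (inv_le_one_of_one_le₀ (by linarith)) (by positivity) f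
  rw [mul_inv_rev]
  calc C * modular B ν ((1 + C.toReal)⁻¹ * k⁻¹) f
      ≤ ENNReal.ofReal C.toReal * (ENNReal.ofReal (1 + C.toReal)⁻¹ * 1) := by
        rw [ENNReal.ofReal_toReal hC]
        gcongr
        exact h1.trans (by gcongr)
    _ ≤ 1 := by
        rw [mul_one, ← ENNReal.ofReal_mul hC0, ENNReal.ofReal_le_one, ← div_eq_mul_inv,
          div_le_one (by positivity)]
        linarith

variable [IsFiniteMeasure ν]

/-- Uniformly bounded differences tending to zero in `L¹` tend to zero in `L^B`. -/
lemma tendsto_of_tendsto_integral_abs {ι : Type*} {l : Filter ι} {u : ι → OrliczSpace B ν}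
    {v : OrliczSpace B ν} {M : ℝ}
    (hM : ∀ i, ∀ᵐ x ∂ν, |(u i : α →ₘ[ν] ℝ) x - (v : α →ₘ[ν] ℝ) x| ≤ M)
    (h : Tendsto (fun i => ∫ x, |(u i : α →ₘ[ν] ℝ) x - (v : α →ₘ[ν] ℝ) x| ∂ν) l (𝓝 0)) :
    Tendsto u l (𝓝 v) := by
  refine tendsto_of_modular_le fun k hk => ?_
  have hM1 : (0 : ℝ) < max M 1 := by positivity
  have h1 := h.const_mul (B (k⁻¹ * max M 1) / max M 1)
  rw [mul_zero] at h1
  filter_upwards [h1.eventually_le_const one_pos] with i hi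
  refine (modular_le_of_abs_le hM1 (inv_pos.2 hk).le ((u i).integrable.sub v.integrable)
    ((hM i).mono fun x hx => hx.trans (le_max_left _ _))).trans ?_
  rwa [ENNReal.ofReal_le_one]

/-- Norm convergence implies `L¹` convergence. -/
lemma tendsto_integral_abs_of_tendsto {ι : Type*} {l : Filter ι} {u : ι → OrliczSpace B ν}
    {v : OrliczSpace B ν} (h : Tendsto u l (𝓝 v)) :
    Tendsto (fun i => ∫ x, |(u i : α →ₘ[ν] ℝ) x - (v : α →ₘ[ν] ℝ) x| ∂ν) l (𝓝 0) := by
  obtain ⟨C, hC0, hC⟩ := exists_integral_abs_mul_le (ν := ν) B zero_le_one one_pos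
  have hn := (tendsto_iff_norm_sub_tendsto_zero.1 h).const_mul
    (1 + C * ∫ _, |(1 : ℝ)| ∂ν)
  rw [mul_zero] at hn
  refine squeeze_zero (fun i => integral_nonneg fun x => abs_nonneg _) (fun i => ?_) hn
  refine le_mul_norm_of_forall_modular fun k hk hk1 => ?_
  rw [modular_congr (OrliczSpace.coeFn_sub _ _)] at hk1
  simpa using hC _ (fun _ => 1) k hk
    (((u i).2.1.sub v.2.1)) hk1 (integrable_const _) (Eventually.of_forall fun x => by simp)

/-- Under `Δ₂`, bounded continuous functions are dense. -/
lemma exists_continuous_norm_sub_lt [TopologicalSpace α] [NormalSpace α] [BorelSpace α]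
    [ν.WeaklyRegular] (hB : DeltaTwo B) (w : OrliczSpace B ν) {η : ℝ} (hη : 0 < η) :
    ∃ h : bddMeasurable α, Continuous h.1 ∧ ‖incl B ν h - w‖ < η := by
  obtain ⟨N, hN⟩ := ((tendsto_iff_norm_sub_tendsto_zero.1 (tendsto_incl_trunc hB w)).eventually
    (gt_mem_nhds (half_pos hη))).exists
  have hwm : Measurable (w : α →ₘ[ν] ℝ) := AEEqFun.measurable _
  let t : bddMeasurable α := ⟨trunc (w : α →ₘ[ν] ℝ) N, trunc_mem_bddMeasurable hwm N⟩
  have htN : ∀ x, |t.1 x| ≤ N := fun x => by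
    dsimp only [t, trunc]
    split_ifs with h
    · exact h
    · simp
  have hti : Integrable t.1 ν := integrable_of_mem_bddMeasurable t.2
  choose g hg hgi using fun j : ℕ =>
    hti.exists_boundedContinuous_integral_sub_le (ε := 1 / ((j : ℝ) + 1)) (by positivity)
  let c : ℕ → bddMeasurable α := fun j => ⟨fun x => max (-(N : ℝ)) (min N (g j x)), by
    refine ⟨measurable_const.max (measurable_const.min (g j).continuous.measurable), N, fun x => ?_⟩
    exact abs_le.2 ⟨le_max_left _ _, max_le (by linarith [Nat.cast_nonneg (α := ℝ) N])
      (min_le_left _ _)⟩⟩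
  have hcont : ∀ j, Continuous (c j).1 := fun j =>
    continuous_const.max (continuous_const.min (g j).continuous)
  have hcN : ∀ j x, |(c j).1 x| ≤ N := fun j x =>
    abs_le.2 ⟨le_max_left _ _, max_le (by linarith [Nat.cast_nonneg (α := ℝ) N])
      (min_le_left _ _)⟩
  -- clamping to `[-N, N]` is `1`-Lipschitz and fixes the values of `t`
  have hclamp : ∀ j x, |(c j).1 x - t.1 x| ≤ ‖t.1 x - g j x‖ := fun j x => by
    have e : t.1 x = max (-(N : ℝ)) (min N (t.1 x)) := by
      rw [min_eq_right (abs_le.1 (htN x)).2, max_eq_right (abs_le.1 (htN x)).1]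
    rw [Real.norm_eq_abs, abs_sub_comm (t.1 x)]
    conv_lhs => rw [e]
    exact (abs_max_sub_max_le_max _ _ _ _).trans (max_le (by simp)
      ((abs_min_sub_min_le_max _ _ _ _).trans (max_le (by simp) le_rfl)))
  have hae : ∀ j, ∀ᵐ x ∂ν, (incl B ν (c j) : α →ₘ[ν] ℝ) x - (incl B ν t : α →ₘ[ν] ℝ) x
      = (c j).1 x - t.1 x := fun j => by
    filter_upwards [coeFn_incl (B := B) (ν := ν) (c j), coeFn_incl (B := B) (ν := ν) t]
      with x h1 h2
    rw [h1, h2]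
  have hlim : Tendsto (fun j => incl B ν (c j)) atTop (𝓝 (incl B ν t)) := by
    refine tendsto_of_tendsto_integral_abs (M := N + N) (fun j => ?_) ?_
    · filter_upwards [hae j] with x hx
      rw [hx]
      exact (abs_sub _ _).trans (add_le_add (hcN j x) (htN x))
    · refine squeeze_zero (fun j => integral_nonneg fun x => abs_nonneg _) (fun j => ?_)
        tendsto_one_div_add_atTop_nhds_zero_nat
      rw [integral_congr_ae ((hae j).mono fun x hx => congrArg abs hx)]
      exact (integral_mono ((integrable_of_mem_bddMeasurable (c j).2).sub hti).abs
        (hti.sub (hgi j)).norm (hclamp j)).trans (hg j)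
  obtain ⟨j, hj⟩ := ((tendsto_iff_norm_sub_tendsto_zero.1 hlim).eventually
    (gt_mem_nhds (half_pos hη))).exists
  refine ⟨c j, hcont j, ?_⟩
  have := norm_sub_le_norm_sub_add_norm_sub (incl B ν (c j)) (incl B ν t) w
  linarith

end Density

/-! ### The unfolding operator -/

namespace RefCell

variable {d : ℕ} (Y : RefCell d) {B : NFunction} {Ω : Set (EuclideanSpace ℝ (Fin d))} {ε : ℝ}

lemma volume_pos : 0 < volume Y.carrier := by
  obtain ⟨z, n, hz, -⟩ := Y.paving.exists
  exact Y.isOpen.measure_pos volume ⟨_, hz⟩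

lemma coeFn_unfolding (hε : 0 < ε) (w : OrliczSpace B (volume.restrict Ω)) :
    (Y.unfolding B Ω hε w : EuclideanSpace ℝ (Fin d) × EuclideanSpace ℝ (Fin d)
        →ₘ[volume.restrict (Ω ×ˢ Y.carrier)] ℝ)
      =ᵐ[volume.restrict (Ω ×ˢ Y.carrier)]
      Y.unfoldFun Ω ε (w : EuclideanSpace ℝ (Fin d) →ₘ[volume.restrict Ω] ℝ) :=
  MemOrlicz.coeFn_toOrlicz _

lemma coeFn_lift (w : OrliczSpace B (volume.restrict Ω)) :
    (Y.lift w : EuclideanSpace ℝ (Fin d) × EuclideanSpace ℝ (Fin d)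
        →ₘ[volume.restrict (Ω ×ˢ Y.carrier)] ℝ)
      =ᵐ[volume.restrict (Ω ×ˢ Y.carrier)]
      fun p => (w : EuclideanSpace ℝ (Fin d) →ₘ[volume.restrict Ω] ℝ) p.1 :=
  MemOrlicz.coeFn_toOrlicz _

lemma coeFn_mean (w : OrliczSpace B (volume.restrict (Ω ×ˢ Y.carrier))) :
    (Y.mean w : EuclideanSpace ℝ (Fin d) →ₘ[volume.restrict Ω] ℝ)
      =ᵐ[volume.restrict Ω]
        Y.meanFun (w : EuclideanSpace ℝ (Fin d) × EuclideanSpace ℝ (Fin d)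
          →ₘ[volume.restrict (Ω ×ˢ Y.carrier)] ℝ) :=
  MemOrlicz.coeFn_toOrlicz _

lemma unfoldFun_sub (φ ψ : EuclideanSpace ℝ (Fin d) → ℝ)
    (p : EuclideanSpace ℝ (Fin d) × EuclideanSpace ℝ (Fin d)) :
    Y.unfoldFun Ω ε (fun x => φ x - ψ x) p = Y.unfoldFun Ω ε φ p - Y.unfoldFun Ω ε ψ p := by
  unfold unfoldFun
  split_ifs <;> simp

lemma unfoldFun_mul (φ ψ : EuclideanSpace ℝ (Fin d) → ℝ)
    (p : EuclideanSpace ℝ (Fin d) × EuclideanSpace ℝ (Fin d)) :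
    Y.unfoldFun Ω ε (fun x => φ x * ψ x) p = Y.unfoldFun Ω ε φ p * Y.unfoldFun Ω ε ψ p := by
  unfold unfoldFun
  split_ifs <;> simp

lemma abs_unfoldFun_le {φ : EuclideanSpace ℝ (Fin d) → ℝ} {M : ℝ} (hM : ∀ x, |φ x| ≤ M)
    (p : EuclideanSpace ℝ (Fin d) × EuclideanSpace ℝ (Fin d)) : |Y.unfoldFun Ω ε φ p| ≤ M := by
  unfold unfoldFun
  split_ifs
  · exact hM _
  · rw [abs_zero]
    exact (abs_nonneg _).trans (hM 0)

lemma luxemburgNorm_unfoldFun_le (hε : 0 < ε) {φ : EuclideanSpace ℝ (Fin d) → ℝ}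
    (hφ : MemOrlicz B (volume.restrict Ω) φ) :
    luxemburgNorm B (volume.restrict (Ω ×ˢ Y.carrier)) (Y.unfoldFun Ω ε φ)
      ≤ (1 + volume.real Y.carrier) * luxemburgNorm B (volume.restrict Ω) φ :=
  luxemburgNorm_le_of_modular_le Y.volume_ne_top hφ fun _ hδ => Y.modular_unfoldFun_le hε hφ.1 hδ

lemma norm_unfolding_le (hε : 0 < ε) (w : OrliczSpace B (volume.restrict Ω)) :
    ‖Y.unfolding B Ω hε w‖ ≤ (1 + volume.real Y.carrier) * ‖w‖ := by
  rw [norm_def, luxemburgNorm_congr (Y.coeFn_unfolding hε w)]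
  exact Y.luxemburgNorm_unfoldFun_le hε w.2

lemma norm_unfolding_sub_le (hε : 0 < ε) (w w' : OrliczSpace B (volume.restrict Ω)) :
    ‖Y.unfolding B Ω hε w - Y.unfolding B Ω hε w'‖
      ≤ (1 + volume.real Y.carrier) * ‖w - w'‖ := by
  have h := OrliczSpace.coeFn_sub w w'
  rw [norm_def, norm_def, luxemburgNorm_congr h]
  refine (luxemburgNorm_congr ?_).trans_le
    (Y.luxemburgNorm_unfoldFun_le hε ((w - w').2.congr h))
  refine (OrliczSpace.coeFn_sub _ _).trans ?_
  filter_upwards [Y.coeFn_unfolding hε w, Y.coeFn_unfolding hε w'] with p h1 h2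
  rw [h1, h2, unfoldFun_sub]

lemma norm_lift_sub_le (w w' : OrliczSpace B (volume.restrict Ω)) :
    ‖Y.lift w - Y.lift w'‖ ≤ (1 + volume.real Y.carrier) * ‖w - w'‖ := by
  have h := OrliczSpace.coeFn_sub w w'
  have hm := (w - w').2.congr h
  rw [norm_def, norm_def, luxemburgNorm_congr h]
  have e : ((Y.lift w - Y.lift w' : OrliczSpace B (volume.restrict (Ω ×ˢ Y.carrier))) :
        EuclideanSpace ℝ (Fin d) × EuclideanSpace ℝ (Fin d) →ₘ[volume.restrict (Ω ×ˢ Y.carrier)] ℝ)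
      =ᵐ[volume.restrict (Ω ×ˢ Y.carrier)]
        fun p => (w : EuclideanSpace ℝ (Fin d) →ₘ[volume.restrict Ω] ℝ) p.1
          - (w' : EuclideanSpace ℝ (Fin d) →ₘ[volume.restrict Ω] ℝ) p.1 := by
    refine (OrliczSpace.coeFn_sub _ _).trans ?_
    filter_upwards [Y.coeFn_lift w, Y.coeFn_lift w'] with p h1 h2
    rw [h1, h2]
  refine (luxemburgNorm_congr e).trans_le
    (luxemburgNorm_le_of_modular_le Y.volume_ne_top hm fun δ hδ => ?_)
  rw [restrict_prod_eq]
  have h1 := lintegral_prod_mul (ν := volume.restrict Y.carrier)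
    (aemeasurable_modular (B := B) hm.1 hδ) (g := fun _ => 1) aemeasurable_const
  simp only [mul_one, lintegral_const, Measure.restrict_apply_univ, one_mul] at h1
  rw [modular, h1, mul_comm]
  rfl

/-- The unfolding of a class does not depend on the representative; the N-function `B` is
auxiliary. -/
lemma unfoldFun_congr (B : NFunction) (hε : 0 < ε) {φ ψ : EuclideanSpace ℝ (Fin d) → ℝ}
    (h : φ =ᵐ[volume.restrict Ω] ψ) :
    Y.unfoldFun Ω ε φ =ᵐ[volume.restrict (Ω ×ˢ Y.carrier)] Y.unfoldFun Ω ε ψ := by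
  have h0 : (fun x => φ x - ψ x) =ᵐ[volume.restrict Ω] 0 := by
    filter_upwards [h] with x hx
    simp [hx]
  have hm : MemOrlicz B (volume.restrict Ω) (fun x => φ x - ψ x) := MemOrlicz.zero.congr h0.symm
  have h1 := Y.luxemburgNorm_unfoldFun_le hε hm
  rw [luxemburgNorm_congr h0, luxemburgNorm_zero, mul_zero] at h1
  filter_upwards [eq_zero_of_luxemburgNorm (Y.memOrlicz_unfoldFun hε hm)
    (le_antisymm h1 (luxemburgNorm_nonneg _))] with p hp
  rw [unfoldFun_sub] at hp
  exact sub_eq_zero.1 hp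

/-- For a continuous function, the unfoldings converge almost everywhere: almost every point of
`Ω` eventually lies in a cell contained in `Ω`, whose diameter tends to zero. -/
lemma tendsto_unfoldFun (hΩ : IsOpen Ω) {ε : ℕ → ℝ} (hε : ∀ n, 0 < ε n)
    (hε0 : Tendsto ε atTop (𝓝 0)) {φ : EuclideanSpace ℝ (Fin d) → ℝ} (hφ : Continuous φ) :
    ∀ᵐ p ∂(volume.restrict (Ω ×ˢ Y.carrier)),
      Tendsto (fun n => Y.unfoldFun Ω (ε n) φ p) atTop (𝓝 (φ p.1)) := by
  have h := Measure.quasiMeasurePreserving_fst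
    (μ := (volume : Measure (EuclideanSpace ℝ (Fin d))))
    (ν := (volume : Measure (EuclideanSpace ℝ (Fin d)))) |>.ae
      (ae_all_iff.2 fun n => Y.ae_paving (hε n))
  filter_upwards [ae_restrict_of_ae h,
    ae_restrict_mem (hΩ.measurableSet.prod Y.isOpen.measurableSet)] with p hp hpΩ
  choose m hm _ using hp
  obtain ⟨D, hD⟩ := Metric.isBounded_iff.1 Y.isBounded
  have hdist : ∀ n, ∀ y ∈ Y.carrier, dist (ε n • (Y.node (m n) + y)) p.1 ≤ ε n * D := by
    intro n y hy
    obtain ⟨z, hz, hzp⟩ := hm n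
    rw [← hzp, dist_smul₀, dist_add_left, Real.norm_of_nonneg (hε n).le]
    exact mul_le_mul_of_nonneg_left (hD hy hz) (hε n).le
  have hlim : Tendsto (fun n => ε n * D) atTop (𝓝 0) := by simpa using hε0.mul_const D
  obtain ⟨r, hr, hball⟩ := Metric.isOpen_iff.1 hΩ p.1 hpΩ.1
  have hpt : Tendsto (fun n => ε n • (Y.node (m n) + p.2)) atTop (𝓝 p.1) :=
    tendsto_iff_dist_tendsto_zero.2
      (squeeze_zero (fun _ => dist_nonneg) (fun n => hdist n _ hpΩ.2) hlim)
  refine ((hφ.tendsto p.1).comp hpt).congr' ?_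
  filter_upwards [hlim.eventually_lt_const hr] with n hn
  refine (Y.unfoldFun_eq (hε n) ?_ φ (hm n)).symm
  rintro _ ⟨y, hy, rfl⟩
  exact hball ((hdist n y hy).trans_lt hn)

/-- The union of the cells contained in `Ω`. -/
def inside (Ω : Set (EuclideanSpace ℝ (Fin d))) (ε : ℝ) : Set (EuclideanSpace ℝ (Fin d)) :=
  ⋃ n : Y.cells Ω ε, Y.scaled ε n Y.carrier

lemma inside_subset : Y.inside Ω ε ⊆ Ω := iUnion_subset fun n => n.2

lemma measurableSet_inside (hε : 0 < ε) : MeasurableSet (Y.inside Ω ε) :=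
  MeasurableSet.iUnion fun n => (Y.isOpen_scaled hε n).measurableSet

lemma disjoint_scaled (hε : 0 < ε) {n m : Fin d → ℤ} (h : n ≠ m) :
    Disjoint (Y.scaled ε n Y.carrier) (Y.scaled ε m Y.carrier) := by
  rw [Set.disjoint_iff_inter_eq_empty, ← Set.not_nonempty_iff_eq_empty]
  exact fun hne => h (Y.eq_of_mem hε hne)

/-- The unfolding preserves integrals, up to the factor `|Y|` and the cells crossing the boundary
of `Ω`. -/
lemma integral_unfoldFun (hε : 0 < ε) (hΩ : MeasurableSet Ω)
    {φ : EuclideanSpace ℝ (Fin d) → ℝ} (hφ : Integrable φ (volume.restrict Ω))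
    (hU : Integrable (Y.unfoldFun Ω ε φ) (volume.restrict (Ω ×ˢ Y.carrier))) :
    ∫ p in Ω ×ˢ Y.carrier, Y.unfoldFun Ω ε φ p
      = volume.real Y.carrier * ∫ x in Y.inside Ω ε, φ x := by
  let S : Y.cells Ω ε → Set (EuclideanSpace ℝ (Fin d) × EuclideanSpace ℝ (Fin d)) :=
    fun n => Y.scaled ε n Y.carrier ×ˢ Y.carrier
  have hS : ∀ n, MeasurableSet (S n) := fun n => Y.measurableSet_cell hε n
  have hSsub : (⋃ n, S n) ⊆ Ω ×ˢ Y.carrier :=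
    iUnion_subset fun n => prod_mono n.2 subset_rfl
  have hSd : Pairwise (Function.onFun Disjoint S) := fun n m hnm =>
    (Y.disjoint_scaled hε fun h => hnm (Subtype.ext h)).set_prod_left _ _
  have h1 : ∫ p in Ω ×ˢ Y.carrier, Y.unfoldFun Ω ε φ p
      = ∫ p in ⋃ n, S n, Y.unfoldFun Ω ε φ p := by
    refine setIntegral_eq_of_subset_of_ae_sdiff_eq_zero
      (hΩ.prod Y.isOpen.measurableSet).nullMeasurableSet hSsub ?_
    filter_upwards [Y.ae_le_iUnion (Ω := Ω) hε] with p hp hpd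
    obtain ⟨n, hn⟩ := mem_iUnion.1 (hp hpd.1)
    exact Y.unfoldFun_eq_zero hε (fun hc => hpd.2 (mem_iUnion.2 ⟨⟨n, hc⟩, hn⟩)) φ hn.1
  have hcell : ∀ n, ∫ p in S n, Y.unfoldFun Ω ε φ p
      = volume.real Y.carrier * ∫ x in Y.scaled ε n Y.carrier, φ x := by
    intro n
    rw [setIntegral_congr_fun (hS n) fun p hp => Y.unfoldFun_eq hε n.2 φ hp.1]
    obtain ⟨hm, c, hc, hvol⟩ := Y.exists_map_eq hε n
    have hφ' : AEStronglyMeasurable φ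
        ((volume.restrict Y.carrier).map fun y => ε • (Y.node n + y)) := by
      rw [hc]
      exact (hφ.1.mono_measure (Measure.restrict_mono_set _ n.2)).smul_measure c
    have h2 := integral_map hm.aemeasurable hφ'
    have h3 := setIntegral_prod_mul (μ := (volume : Measure (EuclideanSpace ℝ (Fin d))))
      (ν := (volume : Measure (EuclideanSpace ℝ (Fin d)))) (fun _ => (1 : ℝ))
      (fun y => φ (ε • (Y.node n + y))) (Y.scaled ε n Y.carrier) Y.carrier
    simp only [one_mul] at h3
    refine (h3.trans ?_)
    rw [← h2, hc, integral_smul_measure, setIntegral_const, smul_eq_mul, smul_eq_mul, mul_one,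
      ← mul_assoc, measureReal_def, ← ENNReal.toReal_mul, hvol, ← measureReal_def]
  rw [h1, integral_iUnion hS hSd (IntegrableOn.mono_set hU hSsub)]
  simp only [hcell]
  rw [tsum_mul_left, inside, integral_iUnion (s := fun n : Y.cells Ω ε => Y.scaled ε n Y.carrier)
    (fun n => (Y.isOpen_scaled hε n).measurableSet)
    (fun n m hnm => Y.disjoint_scaled hε fun h => hnm (Subtype.ext h))
    (IntegrableOn.mono_set hφ Y.inside_subset)]

end RefCell

/-! ### Convergence of the unfoldings -/

/-- Uniform integrability of bounded sequences of `L^B`, in terms of pairings. -/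
lemma tendsto_integral_mul_zero {α : Type*} [MeasurableSpace α] {B : NFunction} {ν : Measure α}
    {f : ℕ → OrliczSpace B ν} {R M : ℝ} {k : ℕ → α → ℝ} (hf : ∀ n, ‖f n‖ ≤ R)
    (hk : ∀ n, Integrable (k n) ν) (hM : ∀ n x, |k n x| ≤ M)
    (h : Tendsto (fun n => ∫ x, |k n x| ∂ν) atTop (𝓝 0)) :
    Tendsto (fun n => ∫ x, (f n : α →ₘ[ν] ℝ) x * k n x ∂ν) atTop (𝓝 0) := by
  have hR : 0 < R + 1 := by linarith [(norm_nonneg _).trans (hf 0)]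
  refine Metric.tendsto_nhds.2 fun η hη => ?_
  obtain ⟨C, hC0, hC⟩ := exists_integral_abs_mul_le (ν := ν) (M := max M 0) B
    (le_max_right M 0) (η := η / (R + 1) / 2) (by positivity)
  have h1 := h.const_mul C
  rw [mul_zero] at h1
  filter_upwards [h1.eventually_lt_const (by positivity : 0 < η / (R + 1) / 2)] with n hn
  have h2 := hC (f n : α →ₘ[ν] ℝ) (k n) (R + 1) hR (f n).2.1
    ((f n).modular_le_one (by linarith [hf n])) (hk n)
    (Eventually.of_forall fun x => (hM n x).trans (le_max_left _ _))
  rw [Real.dist_eq, sub_zero]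
  refine (abs_integral_le_integral_abs.trans h2).trans_lt ?_
  calc (R + 1) * (η / (R + 1) / 2 + C * ∫ x, |k n x| ∂ν)
      < (R + 1) * (η / (R + 1) / 2 + η / (R + 1) / 2) := by gcongr
    _ = η := by field_simp; ring

namespace RefCell

variable {d : ℕ} (Y : RefCell d)

lemma ae_fst (Ω : Set (EuclideanSpace ℝ (Fin d)))
    {P : EuclideanSpace ℝ (Fin d) → Prop} (h : ∀ᵐ x ∂(volume.restrict Ω), P x) :
    ∀ᵐ p ∂(volume.restrict (Ω ×ˢ Y.carrier)), P p.1 := by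
  rw [restrict_prod_eq]
  exact Measure.quasiMeasurePreserving_fst.ae h

/-- Fubini's theorem for the mean value operator. -/
lemma integral_fst_mul {Ω : Set (EuclideanSpace ℝ (Fin d))}
    {h : EuclideanSpace ℝ (Fin d) → ℝ}
    {f : EuclideanSpace ℝ (Fin d) × EuclideanSpace ℝ (Fin d) → ℝ}
    (hf : Integrable (fun p => h p.1 * f p) (volume.restrict (Ω ×ˢ Y.carrier))) :
    ∫ p in Ω ×ˢ Y.carrier, h p.1 * f p
      = volume.real Y.carrier * ∫ x in Ω, h x * Y.meanFun f x := by
  have hV : volume.real Y.carrier ≠ 0 :=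
    (ENNReal.toReal_pos Y.volume_pos.ne' Y.volume_ne_top).ne'
  rw [restrict_prod_eq] at hf ⊢
  rw [integral_prod _ hf, ← integral_const_mul]
  congr 1 with x
  simp only [integral_const_mul]
  rw [meanFun]
  field_simp

variable {B : NFunction} {Ω : Set (EuclideanSpace ℝ (Fin d))}
  {ε : ℕ → ℝ} [IsFiniteMeasure (volume.restrict Ω)]

instance : IsFiniteMeasure (volume.restrict Y.carrier) :=
  isFiniteMeasure_restrict.2 Y.volume_ne_top

instance : IsFiniteMeasure (volume.restrict (Ω ×ˢ Y.carrier)) := by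
  rw [restrict_prod_eq]
  infer_instance

lemma coeFn_lift_incl (h : bddMeasurable (EuclideanSpace ℝ (Fin d))) :
    (Y.lift (incl B (volume.restrict Ω) h) :
        EuclideanSpace ℝ (Fin d) × EuclideanSpace ℝ (Fin d)
          →ₘ[volume.restrict (Ω ×ˢ Y.carrier)] ℝ)
      =ᵐ[volume.restrict (Ω ×ˢ Y.carrier)] fun p => h.1 p.1 := by
  filter_upwards [Y.coeFn_lift (incl B (volume.restrict Ω) h),
    Y.ae_fst Ω (coeFn_incl (B := B) (ν := volume.restrict Ω) h)] with p h1 h2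
  rw [h1, h2]

lemma coeFn_unfolding_incl {ε : ℝ} (hε : 0 < ε) (h : bddMeasurable (EuclideanSpace ℝ (Fin d))) :
    (Y.unfolding B Ω hε (incl B (volume.restrict Ω) h) :
        EuclideanSpace ℝ (Fin d) × EuclideanSpace ℝ (Fin d)
          →ₘ[volume.restrict (Ω ×ˢ Y.carrier)] ℝ)
      =ᵐ[volume.restrict (Ω ×ˢ Y.carrier)] Y.unfoldFun Ω ε h.1 :=
  (Y.coeFn_unfolding hε _).trans (Y.unfoldFun_congr B hε (coeFn_incl h))

lemma tendsto_unfolding_of_continuous (hΩ : IsOpen Ω) (hε : ∀ n, 0 < ε n)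
    (hε0 : Tendsto ε atTop (𝓝 0)) (h : bddMeasurable (EuclideanSpace ℝ (Fin d)))
    (hc : Continuous h.1) :
    Tendsto (fun n => Y.unfolding B Ω (hε n) (incl B (volume.restrict Ω) h)) atTop
      (𝓝 (Y.lift (incl B (volume.restrict Ω) h))) := by
  obtain ⟨C, hC⟩ := h.2.2
  have hae := fun n => (Y.coeFn_unfolding_incl (B := B) (Ω := Ω) (hε n) h).and
    (Y.coeFn_lift_incl (B := B) (Ω := Ω) h)
  have hbd : ∀ n p, |Y.unfoldFun Ω (ε n) h.1 p - h.1 p.1| ≤ C + C := fun n p =>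
    (abs_sub _ _).trans (add_le_add (Y.abs_unfoldFun_le hC p) (hC _))
  refine tendsto_of_tendsto_integral_abs (M := C + C) (fun n => ?_) ?_
  · filter_upwards [hae n] with p hp
    rw [hp.1, hp.2]
    exact hbd n p
  · have hz : Tendsto (fun n => ∫ p in Ω ×ˢ Y.carrier,
        |Y.unfoldFun Ω (ε n) h.1 p - h.1 p.1|) atTop (𝓝 (∫ _ in Ω ×ˢ Y.carrier, 0)) := by
      refine tendsto_integral_of_dominated_convergence (fun _ => C + C) (fun n => ?_)
        (integrable_const _) (fun n => Eventually.of_forall fun p => ?_) ?_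
      · exact ((Y.aestronglyMeasurable_unfoldFun (hε n) h.2.1.aestronglyMeasurable).sub
          (h.2.1.comp measurable_fst).aestronglyMeasurable).norm
      · rw [Real.norm_eq_abs, abs_abs]
        exact hbd n p
      · filter_upwards [Y.tendsto_unfoldFun hΩ hε hε0 hc] with p hp
        simpa using (hp.sub_const (h.1 p.1)).abs
    rw [integral_zero] at hz
    refine hz.congr fun n => integral_congr_ae ?_
    filter_upwards [hae n] with p hp
    rw [hp.1, hp.2]

/-- Strong convergence of the unfoldings of a fixed function: the unfoldings are equicontinuous,
so that it suffices to treat bounded continuous functions. -/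
theorem tendsto_unfolding (hB : DeltaTwo B) (hΩ : IsOpen Ω) (hε : ∀ n, 0 < ε n)
    (hε0 : Tendsto ε atTop (𝓝 0)) (w : OrliczSpace B (volume.restrict Ω)) :
    Tendsto (fun n => Y.unfolding B Ω (hε n) w) atTop (𝓝 (Y.lift w)) := by
  have hV : 0 ≤ volume.real Y.carrier := measureReal_nonneg
  refine Metric.tendsto_nhds.2 fun η hη => ?_
  obtain ⟨h, hc, hh⟩ := exists_continuous_norm_sub_lt hB w
    (η := η / 3 / (1 + volume.real Y.carrier)) (by positivity)
  rw [lt_div_iff₀' (by positivity)] at hh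
  filter_upwards [Metric.tendsto_nhds.1 (Y.tendsto_unfolding_of_continuous (B := B) hΩ hε hε0 h hc)
    (η / 3) (by positivity)] with n hn
  have h1 := Y.norm_unfolding_sub_le (hε n) w (incl B (volume.restrict Ω) h)
  have h2 := Y.norm_lift_sub_le (incl B (volume.restrict Ω) h) w
  rw [norm_sub_rev w] at h1
  rw [← dist_eq_norm (Y.unfolding B Ω (hε n) w)] at h1
  rw [← dist_eq_norm (Y.lift _)] at h2
  have h3 := dist_triangle4 (Y.unfolding B Ω (hε n) w)
    (Y.unfolding B Ω (hε n) (incl B (volume.restrict Ω) h))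
    (Y.lift (incl B (volume.restrict Ω) h)) (Y.lift w)
  linarith

theorem tendsto_unfolding_of_tendsto (hB : DeltaTwo B) (hΩ : IsOpen Ω) (hε : ∀ n, 0 < ε n)
    (hε0 : Tendsto ε atTop (𝓝 0)) {w : ℕ → OrliczSpace B (volume.restrict Ω)}
    {w₀ : OrliczSpace B (volume.restrict Ω)} (hw : Tendsto w atTop (𝓝 w₀)) :
    Tendsto (fun n => Y.unfolding B Ω (hε n) (w n)) atTop (𝓝 (Y.lift w₀)) := by
  have h1 := (tendsto_iff_norm_sub_tendsto_zero.1 hw).const_mul (1 + volume.real Y.carrier)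
  rw [mul_zero] at h1
  have h2 := squeeze_zero_norm (fun n => Y.norm_unfolding_sub_le (hε n) (w n) w₀) h1
  simpa using h2.add (Y.tendsto_unfolding hB hΩ hε hε0 w₀)

lemma tendsto_integral_abs_unfoldFun_sub (hB : DeltaTwo B) (hΩ : IsOpen Ω) (hε : ∀ n, 0 < ε n)
    (hε0 : Tendsto ε atTop (𝓝 0)) (h : bddMeasurable (EuclideanSpace ℝ (Fin d))) :
    Tendsto (fun n => ∫ p in Ω ×ˢ Y.carrier, |Y.unfoldFun Ω (ε n) h.1 p - h.1 p.1|) atTop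
      (𝓝 0) := by
  refine (tendsto_integral_abs_of_tendsto (Y.tendsto_unfolding hB hΩ hε hε0
    (incl B (volume.restrict Ω) h))).congr fun n => integral_congr_ae ?_
  filter_upwards [Y.coeFn_unfolding_incl (B := B) (Ω := Ω) (hε n) h,
    Y.coeFn_lift_incl (B := B) (Ω := Ω) h] with p h1 h2
  rw [h1, h2]

lemma integrable_unfoldFun {ε : ℝ} (hε : 0 < ε) (h : bddMeasurable (EuclideanSpace ℝ (Fin d))) :
    Integrable (Y.unfoldFun Ω ε h.1) (volume.restrict (Ω ×ˢ Y.carrier)) := by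
  obtain ⟨C, hC⟩ := h.2.2
  exact (integrable_const C).mono'
    (Y.aestronglyMeasurable_unfoldFun hε h.2.1.aestronglyMeasurable)
    (Eventually.of_forall fun p => Y.abs_unfoldFun_le hC p)

/-- The boundary layer is negligible in the limit. It is measured by comparing the unfolding of
the constant one with one. -/
lemma tendsto_boundary_layer (hB : DeltaTwo B) (hΩ : IsOpen Ω) (hε : ∀ n, 0 < ε n)
    (hε0 : Tendsto ε atTop (𝓝 0)) :
    Tendsto (fun n => volume.real (Ω \ Y.inside Ω (ε n))) atTop (𝓝 0) := by
  have hΩf : volume Ω ≠ ⊤ := isFiniteMeasure_restrict.1 inferInstance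
  have hV : 0 < volume.real Y.carrier := ENNReal.toReal_pos Y.volume_pos.ne' Y.volume_ne_top
  let one : bddMeasurable (EuclideanSpace ℝ (Fin d)) :=
    ⟨fun _ => 1, measurable_const, 1, fun _ => by simp⟩
  have h1 := (Y.tendsto_integral_abs_unfoldFun_sub hB hΩ hε hε0 one).const_mul
    (volume.real Y.carrier)⁻¹
  rw [mul_zero] at h1
  refine squeeze_zero (fun _ => measureReal_nonneg) (fun n => ?_) h1
  rw [le_inv_mul_iff₀ hV]
  have h2 := Y.integral_unfoldFun (Ω := Ω) (φ := one.1) (hε n) hΩ.measurableSet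
    (integrable_const _) (Y.integrable_unfoldFun (hε n) one)
  have h3 : ∫ p in Ω ×ˢ Y.carrier, (one.1 p.1 - Y.unfoldFun Ω (ε n) one.1 p)
      = volume.real Y.carrier * volume.real (Ω \ Y.inside Ω (ε n)) := by
    rw [integral_sub (integrable_const _) (Y.integrable_unfoldFun (hε n) one), h2,
      measureReal_sdiff Y.inside_subset (Y.measurableSet_inside (hε n)) hΩf]
    simp only [one, setIntegral_const, smul_eq_mul, mul_one]
    rw [Measure.volume_eq_prod, measureReal_prod_prod]
    ring
  rw [← h3]
  refine integral_mono ((integrable_const _).sub (Y.integrable_unfoldFun (hε n) one))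
    ((Y.integrable_unfoldFun (hε n) one).sub (integrable_const _)).abs fun p => ?_
  rw [← abs_neg, neg_sub]
  exact le_abs_self _

/-- Along a bounded sequence whose unfoldings converge weakly, pairings with bounded functions
converge: unfolding both factors preserves their pairing up to the boundary layer, and the unfolded
test function converges strongly. -/
lemma tendsto_pairing (hB : DeltaTwo B) (hΩ : IsOpen Ω) (hε : ∀ n, 0 < ε n)
    (hε0 : Tendsto ε atTop (𝓝 0)) {w : ℕ → OrliczSpace B (volume.restrict Ω)} {R : ℝ}
    (hw : ∀ n, ‖w n‖ ≤ R) {w' : OrliczSpace B (volume.restrict (Ω ×ˢ Y.carrier))}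
    (hw' : WeaklyTendsto (fun n => Y.unfolding B Ω (hε n) (w n)) w')
    (h : bddMeasurable (EuclideanSpace ℝ (Fin d))) :
    Tendsto (fun n => pairing B (volume.restrict Ω) h (w n)) atTop
      (𝓝 (pairing B (volume.restrict Ω) h (Y.mean w'))) := by
  have hV : 0 < volume.real Y.carrier := ENNReal.toReal_pos Y.volume_pos.ne' Y.volume_ne_top
  have hΩf : volume Ω ≠ ⊤ := isFiniteMeasure_restrict.1 inferInstance
  obtain ⟨C, hC⟩ := h.2.2
  have hC0 : 0 ≤ C := (abs_nonneg _).trans (hC 0)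
  let h₂ : bddMeasurable (EuclideanSpace ℝ (Fin d) × EuclideanSpace ℝ (Fin d)) :=
    ⟨fun p => h.1 p.1, h.2.1.comp measurable_fst, C, fun p => hC _⟩
  have hS : ∀ n, MeasurableSet (Ω \ Y.inside Ω (ε n)) := fun n =>
    hΩ.measurableSet.diff (Y.measurableSet_inside (hε n))
  have hmain := tendsto_toWeakSpace_iff.1 hw' (pairing B (volume.restrict (Ω ×ˢ Y.carrier)) h₂)
  have hlim : pairing B (volume.restrict (Ω ×ˢ Y.carrier)) h₂ w'
      = volume.real Y.carrier * pairing B (volume.restrict Ω) h (Y.mean w') := by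
    rw [pairing_apply, pairing_apply]
    refine (Y.integral_fst_mul (integrable_bdd_mul h₂ w')).trans ?_
    congr 1
    refine integral_congr_ae ?_
    filter_upwards [Y.coeFn_mean w'] with x hx
    rw [hx]
  -- the error from replacing the unfolded test function by the test function
  have hU : ∀ n, Integrable (fun p => Y.unfoldFun Ω (ε n) h.1 p - h.1 p.1)
      (volume.restrict (Ω ×ˢ Y.carrier)) := fun n =>
    (Y.integrable_unfoldFun (hε n) h).sub (integrable_of_mem_bddMeasurable h₂.2)
  have hUC : ∀ n p, |Y.unfoldFun Ω (ε n) h.1 p - h.1 p.1| ≤ C + C := fun n p =>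
    (abs_sub _ _).trans (add_le_add (Y.abs_unfoldFun_le hC p) (hC _))
  have herr := tendsto_integral_mul_zero (f := fun n => Y.unfolding B Ω (hε n) (w n))
    (R := (1 + volume.real Y.carrier) * R)
    (fun n => (Y.norm_unfolding_le (hε n) (w n)).trans (by gcongr; exact hw n)) hU hUC
    (Y.tendsto_integral_abs_unfoldFun_sub hB hΩ hε hε0 h)
  -- the error from the boundary layer
  have hlayer := tendsto_integral_mul_zero (f := w) (R := R) (M := C)
    (k := fun n => (Ω \ Y.inside Ω (ε n)).indicator h.1) hw
    (fun n => (integrable_of_mem_bddMeasurable h.2).indicator (hS n))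
    (fun n x => (norm_indicator_le_norm_self h.1 x).trans (hC x)) (by
      have hz := (Y.tendsto_boundary_layer hB hΩ hε hε0).const_mul C
      rw [mul_zero] at hz
      refine squeeze_zero (fun n => integral_nonneg fun x => abs_nonneg _) (fun n => ?_) hz
      have e : ∫ x in Ω, (Ω \ Y.inside Ω (ε n)).indicator (fun _ => C) x
          = C * volume.real (Ω \ Y.inside Ω (ε n)) := by
        rw [setIntegral_indicator (hS n), inter_eq_right.2 sdiff_subset, setIntegral_const,
          smul_eq_mul, mul_comm]
      rw [← e]
      refine integral_mono ((integrable_of_mem_bddMeasurable h.2).indicator (hS n)).abs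
        ((integrable_const C).indicator (hS n)) fun x => ?_
      by_cases hx : x ∈ Ω \ Y.inside Ω (ε n)
      · simpa only [indicator_of_mem hx] using hC x
      · simp only [indicator_of_notMem hx, abs_zero, le_refl])
  have hsum := (hmain.add herr).add (hlayer.const_mul (volume.real Y.carrier))
  rw [hlim, add_zero, mul_zero, add_zero] at hsum
  have hfin := hsum.const_mul (volume.real Y.carrier)⁻¹
  rw [inv_mul_cancel_left₀ hV.ne'] at hfin
  refine hfin.congr fun n => ?_
  rw [inv_mul_eq_iff_eq_mul₀ hV.ne']
  have hi1 := integrable_bdd_mul h₂ (Y.unfolding B Ω (hε n) (w n))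
  have hUb : Integrable (fun p => Y.unfoldFun Ω (ε n) h.1 p
      * (Y.unfolding B Ω (hε n) (w n) : EuclideanSpace ℝ (Fin d) × EuclideanSpace ℝ (Fin d)
        →ₘ[volume.restrict (Ω ×ˢ Y.carrier)] ℝ) p) (volume.restrict (Ω ×ˢ Y.carrier)) :=
    (Y.unfolding B Ω (hε n) (w n)).integrable.bdd_mul (Y.integrable_unfoldFun (hε n) h).1
      (Eventually.of_forall (Y.abs_unfoldFun_le hC))
  have hae : (fun p => Y.unfoldFun Ω (ε n) h.1 p
      * (Y.unfolding B Ω (hε n) (w n) : EuclideanSpace ℝ (Fin d) × EuclideanSpace ℝ (Fin d)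
        →ₘ[volume.restrict (Ω ×ˢ Y.carrier)] ℝ) p)
      =ᵐ[volume.restrict (Ω ×ˢ Y.carrier)] Y.unfoldFun Ω (ε n)
        (fun x => h.1 x * (w n : EuclideanSpace ℝ (Fin d) →ₘ[volume.restrict Ω] ℝ) x) := by
    filter_upwards [Y.coeFn_unfolding (hε n) (w n)] with p hp
    rw [hp, unfoldFun_mul]
  have hhw := integrable_bdd_mul h (w n)
  have h1 := Y.integral_unfoldFun (hε n) hΩ.measurableSet hhw (hUb.congr hae)
  rw [← integral_congr_ae hae] at h1
  have h2 : ∫ p in Ω ×ˢ Y.carrier, Y.unfoldFun Ω (ε n) h.1 p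
      * (Y.unfolding B Ω (hε n) (w n) : EuclideanSpace ℝ (Fin d) × EuclideanSpace ℝ (Fin d)
        →ₘ[volume.restrict (Ω ×ˢ Y.carrier)] ℝ) p
      = pairing B (volume.restrict (Ω ×ˢ Y.carrier)) h₂ (Y.unfolding B Ω (hε n) (w n))
        + ∫ p in Ω ×ˢ Y.carrier,
          (Y.unfolding B Ω (hε n) (w n) : EuclideanSpace ℝ (Fin d) × EuclideanSpace ℝ (Fin d)
            →ₘ[volume.restrict (Ω ×ˢ Y.carrier)] ℝ) p
          * (Y.unfoldFun Ω (ε n) h.1 p - h.1 p.1) := by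
    have e : ∀ p, (Y.unfolding B Ω (hε n) (w n) :
          EuclideanSpace ℝ (Fin d) × EuclideanSpace ℝ (Fin d)
            →ₘ[volume.restrict (Ω ×ˢ Y.carrier)] ℝ) p
          * (Y.unfoldFun Ω (ε n) h.1 p - h.1 p.1)
        = Y.unfoldFun Ω (ε n) h.1 p * (Y.unfolding B Ω (hε n) (w n) :
          EuclideanSpace ℝ (Fin d) × EuclideanSpace ℝ (Fin d)
            →ₘ[volume.restrict (Ω ×ˢ Y.carrier)] ℝ) p
          - h₂.1 p * (Y.unfolding B Ω (hε n) (w n) :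
          EuclideanSpace ℝ (Fin d) × EuclideanSpace ℝ (Fin d)
            →ₘ[volume.restrict (Ω ×ˢ Y.carrier)] ℝ) p := fun p => by
      simp only [h₂]
      ring
    simp only [e]
    rw [integral_sub hUb hi1, pairing_apply, add_sub_cancel]
  have h3 : ∫ x in Ω, (w n : EuclideanSpace ℝ (Fin d) →ₘ[volume.restrict Ω] ℝ) x
      * (Ω \ Y.inside Ω (ε n)).indicator h.1 x
      = pairing B (volume.restrict Ω) h (w n) - ∫ x in Y.inside Ω (ε n),
        h.1 x * (w n : EuclideanSpace ℝ (Fin d) →ₘ[volume.restrict Ω] ℝ) x := by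
    have e : ∀ x, (w n : EuclideanSpace ℝ (Fin d) →ₘ[volume.restrict Ω] ℝ) x
        * (Ω \ Y.inside Ω (ε n)).indicator h.1 x
        = (Ω \ Y.inside Ω (ε n)).indicator (fun x => h.1 x
          * (w n : EuclideanSpace ℝ (Fin d) →ₘ[volume.restrict Ω] ℝ) x) x := fun x => by
      by_cases hx : x ∈ Ω \ Y.inside Ω (ε n)
      · simp only [indicator_of_mem hx, mul_comm]
      · simp only [indicator_of_notMem hx, mul_zero]
    simp only [e]
    rw [setIntegral_indicator (hS n), inter_eq_right.2 sdiff_subset,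
      setIntegral_sdiff (Y.measurableSet_inside (hε n)) hhw Y.inside_subset, pairing_apply]
  rw [← h2, h1, h3]
  ring

theorem weaklyTendsto_mean (hB : DeltaTwo B) (hB' : NablaTwo B) (hΩ : IsOpen Ω)
    (hε : ∀ n, 0 < ε n) (hε0 : Tendsto ε atTop (𝓝 0))
    {w : ℕ → OrliczSpace B (volume.restrict Ω)} {R : ℝ} (hw : ∀ n, ‖w n‖ ≤ R)
    {w' : OrliczSpace B (volume.restrict (Ω ×ˢ Y.carrier))}
    (hw' : WeaklyTendsto (fun n => Y.unfolding B Ω (hε n) (w n)) w') :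
    WeaklyTendsto w (Y.mean w') := by
  refine tendsto_toWeakSpace_iff.2 fun ℓ => Metric.tendsto_nhds.2 fun η hη => ?_
  have hR : 0 ≤ R := (norm_nonneg _).trans (hw 0)
  obtain ⟨h, hh⟩ := exists_norm_sub_pairing_le hB hB' ℓ
    (η := η / 3 / (R + ‖Y.mean w'‖ + 1)) (by positivity)
  rw [le_div_iff₀ (by positivity)] at hh
  filter_upwards [Metric.tendsto_nhds.1 (Y.tendsto_pairing hB hΩ hε hε0 hw hw' h) (η / 3)
    (by positivity)] with n hn
  have key : ∀ f : OrliczSpace B (volume.restrict Ω), ‖f‖ ≤ R + ‖Y.mean w'‖ + 1 →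
      dist (ℓ f) (pairing B (volume.restrict Ω) h f) ≤ η / 3 := fun f hf => by
    rw [dist_eq_norm, ← sub_apply]
    exact ((ℓ - pairing B (volume.restrict Ω) h).le_opNorm_of_le hf).trans hh
  have h1 := key (w n) (by linarith [hw n, norm_nonneg (Y.mean w')])
  have h2 := key (Y.mean w') (by linarith)
  rw [dist_comm] at h2
  have h3 := dist_triangle4 (ℓ (w n)) (pairing B (volume.restrict Ω) h (w n))
    (pairing B (volume.restrict Ω) h (Y.mean w')) (ℓ (Y.mean w'))
  linarith

end RefCell
end Unfolding

end

open Unfolding in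
theorem theorem1 {d : ℕ} (hd : 0 < d) (Y : RefCell d) (B : NFunction)
    (hB : DeltaTwo B) (hB' : NablaTwo B)
    (Ω : Set (EuclideanSpace ℝ (Fin d))) (hΩ : IsOpen Ω) (hΩb : Bornology.IsBounded Ω)
    (ε : ℕ → ℝ) (hε : ∀ n, 0 < ε n) (hε0 : Tendsto ε atTop (𝓝 0)) :
    -- (i)
    (∀ w : OrliczSpace B (volume.restrict Ω),
      Tendsto (fun n => Y.unfolding B Ω (hε n) w) atTop (𝓝 (Y.lift w))) ∧
    -- (ii)
    (∀ (w : ℕ → OrliczSpace B (volume.restrict Ω)) (w₀ : OrliczSpace B (volume.restrict Ω)),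
      Tendsto w atTop (𝓝 w₀) →
      Tendsto (fun n => Y.unfolding B Ω (hε n) (w n)) atTop (𝓝 (Y.lift w₀))) ∧
    -- (iii)
    (∀ w : ℕ → OrliczSpace B (volume.restrict Ω), RelWeaklyCompact w →
      RelWeaklyCompact (fun n => Y.unfolding B Ω (hε n) (w n)) ∧
      ∀ w' : OrliczSpace B (volume.restrict (Ω ×ˢ Y.carrier)),
        WeaklyTendsto (fun n => Y.unfolding B Ω (hε n) (w n)) w' →
        WeaklyTendsto w (Y.mean w')) ∧
    -- (iv)
    (∀ (w : ℕ → OrliczSpace B (volume.restrict Ω))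
      (w' : OrliczSpace B (volume.restrict (Ω ×ˢ Y.carrier))),
      WeaklyTendsto (fun n => Y.unfolding B Ω (hε n) (w n)) w' →
      ‖w'‖ₑ ≤ liminf (fun n => (1 + volume Y.carrier) * ‖w n‖ₑ) atTop) := by
  have : IsFiniteMeasure (volume.restrict Ω) :=
    isFiniteMeasure_restrict.2 hΩb.measure_lt_top.ne
  refine ⟨Y.tendsto_unfolding hB hΩ hε hε0,
    fun w w₀ hw => Y.tendsto_unfolding_of_tendsto hB hΩ hε hε0 hw, fun w hw => ?_,
    fun w w' hw' => ?_⟩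
  · obtain ⟨R, hR⟩ := hw.exists_norm_le
    refine ⟨relWeaklyCompact_of_norm_le (exists_eq_eval hB hB')
      (R := (1 + volume.real Y.carrier) * R) fun n => ?_,
      fun w' hw' => Y.weaklyTendsto_mean hB hB' hΩ hε hε0 hR hw'⟩
    exact (Y.norm_unfolding_le (hε n) (w n)).trans (by gcongr; exact hR n)
  · refine hw'.enorm_le_liminf.trans (liminf_le_liminf (Eventually.of_forall fun n => ?_))
    have h1 := ENNReal.ofReal_le_ofReal (Y.norm_unfolding_le (hε n) (w n))
    rw [ENNReal.ofReal_mul (by positivity), ENNReal.ofReal_add zero_le_one measureReal_nonneg,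
      ENNReal.ofReal_one, measureReal_def, ENNReal.ofReal_toReal Y.volume_ne_top,
      ofReal_norm, ofReal_norm] at h1
    exact h1
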